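/- Let $N\ge 1$, let $\Omega\subseteq\mathbb R^N$ be a bounded domain with $C^2$ boundary, let $1<p<q<\infty$ and $\alpha,\beta>0$. Let $\hat\lambda_1(q)$ be the principal (smallest) eigenvalue of $(-\Delta_q,W^{1,q}_0(\Omega))$, i.e. the smallest $\mu\in\mathbb R$ for which $-\Delta_q u=\mu|u|^{q-2}u$ in $\Omega$, $u|_{\partial\Omega}=0$, has a nontrivial weak solution $u\in W^{1,q}_0(\Omega)$. For $\lambda\in\mathbb R$ define $$\varphi_\lambda(u)=\frac{\alpha}{p}\|Du\|_p^p+\frac{\beta}{q}\|Du\|_q^q-\frac{\lambda}{q}\|u\|_q^q,\qquad u\in W^{1,q}_0(\Omega),$$ the Nehari manifold $$N_\lambda=\{u\in W^{1,q}_0(\Omega):\ \langle\varphi_\lambda'(u),u\rangle=0,\ u\neq 0\},$$ and $m_\lambda=\inf\{\varphi_\lambda(u):u\in N_\lambda\}$. If $\lambda>\beta\hat\lambda_1(q)$, then there exists $\hat u_\lambda\in N_\lambda$ such that $\varphi_\lambda(\hat u_\lambda)=m_\lambda$; that is, the infimum $m_\lambda$ is attained on $N_\lambda$. -/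

import Mathlib

open MeasureTheory Set
open scoped ENNReal ContDiff

noncomputable section

namespace DoublePhase

instance factOneLeOfReal (r : ℝ) [h : Fact (1 < r)] : Fact (1 ≤ ENNReal.ofReal r) :=
  ⟨by simpa using h.out.le⟩

/-- A bounded domain (nonempty, open, connected) of `ℝ^N` with `C^2` boundary: near each boundary
point, `Ω` is the strict sublevel set of a `C^2` function whose differential does not vanish
there. -/
structure IsBoundedC2Domain {N : ℕ} (Ω : Set (EuclideanSpace ℝ (Fin N))) : Prop where
  isOpen : IsOpen Ω
  isConnected : IsConnected Ω
  isBounded : Bornology.IsBounded Ω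
  boundary : ∀ x ∈ frontier Ω, ∃ (U : Set (EuclideanSpace ℝ (Fin N)))
    (g : EuclideanSpace ℝ (Fin N) → ℝ), IsOpen U ∧ x ∈ U ∧ ContDiffOn ℝ 2 g U ∧
      fderiv ℝ g x ≠ 0 ∧ Ω ∩ U = {y ∈ U | g y < 0}

/-- `f` is in `C_c^∞(Ω)`. -/
structure IsTestFunction {N : ℕ} (Ω : Set (EuclideanSpace ℝ (Fin N)))
    (f : EuclideanSpace ℝ (Fin N) → ℝ) : Prop where
  contDiff : ContDiff ℝ ∞ f
  hasCompactSupport : HasCompactSupport f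
  tsupport_subset : tsupport f ⊆ Ω

/-- `G` is the weak (distributional) gradient of `u` in `Ω`. -/
def IsWeakGradient {N : ℕ} (Ω : Set (EuclideanSpace ℝ (Fin N)))
    (u : EuclideanSpace ℝ (Fin N) → ℝ)
    (G : EuclideanSpace ℝ (Fin N) → EuclideanSpace ℝ (Fin N)) : Prop :=
  ∀ f, IsTestFunction Ω f → ∀ v : EuclideanSpace ℝ (Fin N),
    ∫ x in Ω, u x * fderiv ℝ f x v = - ∫ x in Ω, inner ℝ (G x) v * f x

theorem IsTestFunction.zero {N : ℕ} (Ω : Set (EuclideanSpace ℝ (Fin N))) :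
    IsTestFunction Ω (0 : EuclideanSpace ℝ (Fin N) → ℝ) :=
  ⟨contDiff_const, HasCompactSupport.zero, by simp [tsupport]⟩

theorem IsTestFunction.add {N : ℕ} {Ω : Set (EuclideanSpace ℝ (Fin N))}
    {f g : EuclideanSpace ℝ (Fin N) → ℝ} (hf : IsTestFunction Ω f) (hg : IsTestFunction Ω g) :
    IsTestFunction Ω (f + g) :=
  ⟨hf.contDiff.add hg.contDiff, hf.hasCompactSupport.add hg.hasCompactSupport,
    (tsupport_add f g).trans (union_subset hf.tsupport_subset hg.tsupport_subset)⟩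

theorem IsTestFunction.smul {N : ℕ} {Ω : Set (EuclideanSpace ℝ (Fin N))}
    {f : EuclideanSpace ℝ (Fin N) → ℝ} (c : ℝ) (hf : IsTestFunction Ω f) :
    IsTestFunction Ω (c • f) :=
  ⟨contDiff_const.smul hf.contDiff, hf.hasCompactSupport.smul_left (f := fun _ => c),
    (tsupport_smul_subset_right (fun _ => c) f).trans hf.tsupport_subset⟩

/-- An `L^r` function times a bounded one with compact support, continuous, is integrable. -/
theorem integrable_mul_of_compact {N : ℕ} (Ω : Set (EuclideanSpace ℝ (Fin N))) {r : ℝ}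
    [Fact (1 < r)] {u k : EuclideanSpace ℝ (Fin N) → ℝ}
    (hu : MemLp u (ENNReal.ofReal r) (volume.restrict Ω)) (hk : Continuous k)
    (hc : HasCompactSupport k) : Integrable (fun x => u x * k x) (volume.restrict Ω) := by
  have h1 : LocallyIntegrable u (volume.restrict Ω) :=
    hu.locallyIntegrable (Fact.out : 1 ≤ ENNReal.ofReal r)
  simpa [mul_comm] using h1.integrable_smul_left_of_hasCompactSupport hk hc

/-- The Sobolev space `W^{1,r}(Ω)`, as the space of pairs `(u, Du)` in
`L^r(Ω) × L^r(Ω; ℝ^N)` with `Du` the weak gradient of `u`.  It carries the norm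
`max ‖u‖_r ‖Du‖_r`, which is equivalent to the other usual ones. -/
def sobolev {N : ℕ} (r : ℝ) [Fact (1 < r)] (Ω : Set (EuclideanSpace ℝ (Fin N))) :
    Submodule ℝ (Lp ℝ (ENNReal.ofReal r) (volume.restrict Ω) ×
      Lp (EuclideanSpace ℝ (Fin N)) (ENNReal.ofReal r) (volume.restrict Ω)) where
  carrier := {w | IsWeakGradient Ω w.1 w.2}
  zero_mem' := by
    intro f _ v
    have h1 : ∀ᵐ x ∂(volume.restrict Ω),
        ((0 : Lp ℝ (ENNReal.ofReal r) (volume.restrict Ω)) x) = 0 := Lp.coeFn_zero _ _ _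
    have h2 : ∀ᵐ x ∂(volume.restrict Ω), ((0 : Lp (EuclideanSpace ℝ (Fin N))
        (ENNReal.ofReal r) (volume.restrict Ω)) x) = 0 := Lp.coeFn_zero _ _ _
    have e1 := integral_congr_ae (μ := volume.restrict Ω)
      (h1.mono fun x hx => congrArg (· * fderiv ℝ f x v) hx)
    have e2 := integral_congr_ae (μ := volume.restrict Ω)
      (h2.mono fun x hx => congrArg (fun z => inner ℝ z v * f x) hx)
    simp only [zero_mul, inner_zero_left, integral_zero] at e1 e2
    simp only [Prod.fst_zero, Prod.snd_zero, e1, e2, neg_zero]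
  add_mem' := by
    intro a b ha hb f hf v
    have hd : Continuous fun x => fderiv ℝ f x v :=
      (hf.contDiff.continuous_fderiv (by simp)).clm_apply continuous_const
    have hdc : HasCompactSupport fun x => fderiv ℝ f x v :=
      hf.hasCompactSupport.fderiv_apply (𝕜 := ℝ) v
    have i1 := integrable_mul_of_compact Ω (Lp.memLp a.1) hd hdc
    have i2 := integrable_mul_of_compact Ω (Lp.memLp b.1) hd hdc
    have j1 := integrable_mul_of_compact Ω ((Lp.memLp a.2).inner_const v)
      hf.contDiff.continuous hf.hasCompactSupport
    have j2 := integrable_mul_of_compact Ω ((Lp.memLp b.2).inner_const v)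
      hf.contDiff.continuous hf.hasCompactSupport
    have e1 : ∫ x in Ω, (a + b).1 x * fderiv ℝ f x v
        = ∫ x in Ω, (a.1 x * fderiv ℝ f x v + b.1 x * fderiv ℝ f x v) := by
      refine integral_congr_ae ((Lp.coeFn_add a.1 b.1).mono fun x hx => ?_)
      simp only [Prod.fst_add, hx, Pi.add_apply, add_mul]
    have e2 : ∫ x in Ω, inner ℝ ((a + b).2 x) v * f x
        = ∫ x in Ω, (inner ℝ (a.2 x) v * f x + inner ℝ (b.2 x) v * f x) := by
      refine integral_congr_ae ((Lp.coeFn_add a.2 b.2).mono fun x hx => ?_)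
      simp only [Prod.snd_add, hx, Pi.add_apply, inner_add_left, add_mul]
    rw [e1, e2, integral_add i1 i2, integral_add j1 j2, ha f hf v, hb f hf v, neg_add]
  smul_mem' := by
    intro c a ha f hf v
    have e1 : ∫ x in Ω, (c • a).1 x * fderiv ℝ f x v
        = ∫ x in Ω, c * (a.1 x * fderiv ℝ f x v) := by
      refine integral_congr_ae ((Lp.coeFn_smul c a.1).mono fun x hx => ?_)
      simp only [Prod.smul_fst, hx, Pi.smul_apply, smul_eq_mul, mul_assoc]
    have e2 : ∫ x in Ω, inner ℝ ((c • a).2 x) v * f x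
        = ∫ x in Ω, c * (inner ℝ (a.2 x) v * f x) := by
      refine integral_congr_ae ((Lp.coeFn_smul c a.2).mono fun x hx => ?_)
      simp only [Prod.smul_snd, hx, Pi.smul_apply, real_inner_smul_left, mul_assoc]
    rw [e1, e2, integral_const_mul, integral_const_mul, ha f hf v, mul_neg]

/-- `C_c^∞(Ω)` as a subspace of `W^{1,r}(Ω)`. -/
def testSubspace {N : ℕ} (r : ℝ) [Fact (1 < r)] (Ω : Set (EuclideanSpace ℝ (Fin N))) :
    Submodule ℝ (sobolev r Ω) where
  carrier := {w | ∃ f, IsTestFunction Ω f ∧ w.1.1 =ᵐ[volume.restrict Ω] f}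
  zero_mem' := ⟨0, IsTestFunction.zero Ω, Lp.coeFn_zero _ _ _⟩
  add_mem' := by
    rintro a b ⟨f, hf, haf⟩ ⟨g, hg, hbg⟩
    exact ⟨f + g, hf.add hg, (Lp.coeFn_add a.1.1 b.1.1).trans (haf.add hbg)⟩
  smul_mem' := by
    rintro c a ⟨f, hf, haf⟩
    exact ⟨c • f, hf.smul c, (Lp.coeFn_smul c a.1.1).trans (haf.const_smul c)⟩

/-- The Sobolev space `W^{1,r}_0(Ω)`: the closure of `C_c^∞(Ω)` in `W^{1,r}(Ω)`. -/
def sobolevZero {N : ℕ} (r : ℝ) [Fact (1 < r)] (Ω : Set (EuclideanSpace ℝ (Fin N))) :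
    Submodule ℝ (sobolev r Ω) :=
  (testSubspace r Ω).topologicalClosure

/-- The function underlying an element of `W^{1,r}_0(Ω)`. -/
def fn {N : ℕ} {r : ℝ} [Fact (1 < r)] {Ω : Set (EuclideanSpace ℝ (Fin N))}
    (u : sobolevZero r Ω) : EuclideanSpace ℝ (Fin N) → ℝ :=
  u.1.1.1

/-- The weak gradient `Du` of an element `u` of `W^{1,r}_0(Ω)`. -/
def grad {N : ℕ} {r : ℝ} [Fact (1 < r)] {Ω : Set (EuclideanSpace ℝ (Fin N))}
    (u : sobolevZero r Ω) : EuclideanSpace ℝ (Fin N) → EuclideanSpace ℝ (Fin N) :=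
  u.1.1.2

/-- `mu` is an eigenvalue of `(-Δ_r, W^{1,r}_0(Ω))`: the problem `-Δ_r u = mu |u|^{r-2} u` in `Ω`,
`u = 0` on the boundary, has a nontrivial weak solution. -/
def IsEigenvalue {N : ℕ} (r : ℝ) [Fact (1 < r)] (Ω : Set (EuclideanSpace ℝ (Fin N)))
    (mu : ℝ) : Prop :=
  ∃ u : sobolevZero r Ω, u ≠ 0 ∧ ∀ h : sobolevZero r Ω,
    ∫ x in Ω, ‖grad u x‖ ^ (r - 2) * inner ℝ (grad u x) (grad h x)
      = mu * ∫ x in Ω, |fn u x| ^ (r - 2) * fn u x * fn h x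

/-- The principal (smallest) eigenvalue of `(-Δ_r, W^{1,r}_0(Ω))`. -/
def principalEigenvalue {N : ℕ} (r : ℝ) [Fact (1 < r)]
    (Ω : Set (EuclideanSpace ℝ (Fin N))) : ℝ :=
  sInf {mu | IsEigenvalue r Ω mu}

/-- The energy functional on `W^{1,q}_0(Ω)` (for `p < q`),
`u ↦ (α/p) ‖Du‖_p^p + (β/q) ‖Du‖_q^q - (lam/q) ‖u‖_q^q`. -/
def energy {N : ℕ} (p q : ℝ) [Fact (1 < q)] (Ω : Set (EuclideanSpace ℝ (Fin N)))
    (α β lam : ℝ) (u : sobolevZero q Ω) : ℝ :=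
  α / p * (∫ x in Ω, ‖grad u x‖ ^ p) + β / q * (∫ x in Ω, ‖grad u x‖ ^ q)
    - lam / q * (∫ x in Ω, |fn u x| ^ q)

/-- The Nehari manifold of the energy functional, formed with its Fréchet derivative on
`W^{1,q}_0(Ω)`. -/
def nehari {N : ℕ} (p q : ℝ) [Fact (1 < q)] (Ω : Set (EuclideanSpace ℝ (Fin N)))
    (α β lam : ℝ) : Set (sobolevZero q Ω) :=
  {u | fderiv ℝ (energy p q Ω α β lam) u u = 0 ∧ u ≠ 0}

/-- The infimum of the energy over the Nehari manifold. -/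
def nehariInf {N : ℕ} (p q : ℝ) [Fact (1 < q)] (Ω : Set (EuclideanSpace ℝ (Fin N)))
    (α β lam : ℝ) : ℝ :=
  sInf (energy p q Ω α β lam '' nehari p q Ω α β lam)

end DoublePhase

end

noncomputable section

namespace DoublePhase

/-! Put D(u) = λ‖u‖_q^q − β‖Du‖_q^q. Testing the derivative of the energy against u itself turns the
Nehari constraint into α‖Du‖_p^p = D(u) (`mem_nehari_iff`), and under it the energy collapses to
α(1/p − 1/q)‖Du‖_p^p (`energy_eq_of_mem_nehari`). A ray through u ≠ 0 with D(u) > 0 meets the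
manifold in exactly one positive multiple of u, and there the quotient ‖Du‖_p^q / D(u), which is
constant along rays, equals ‖Du‖_p^(q−p) / α. Minimising the energy on the manifold is therefore the
same as minimising this quotient over {D > 0} (`exists_ratio_minimizer`,
`exists_scaled_ratio_minimizer`).

The set {D > 0} is nonempty because some eigenvalue μ lies below λ/β and its eigenfunction satisfies
‖Du‖_q^q = μ‖u‖_q^q. Since the principal eigenvalue is an `sInf`, this needs the existence of an
eigenvalue, obtained from a minimiser of the Rayleigh quotient.

Both minimisers come from the direct method. With ‖u‖_q = 1 a minimising sequence has bounded
gradients. Rellich-Kondrachov, proved by approximating the inclusion by averages over small cubes,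
makes the functions converge strongly in L^q. Weak compactness for the gradients is replaced by
uniform convexity of L^q: almost norm-minimal elements of the convex hulls of the tails form a
Cauchy sequence, and the limit lies in every closed convex set that eventually contains the sequence
(`exists_mem_of_closed_convex`). Lower semicontinuity is this property applied to convex sublevel
sets. Poincaré's inequality excludes a vanishing limit gradient. -/

/-! ### Convexity and differentiability of ‖x‖^q, pointwise -/

theorem convexOn_norm_rpow {E : Type*} [SeminormedAddCommGroup E] [NormedSpace ℝ E] {q : ℝ}
    (hq : 1 ≤ q) : ConvexOn ℝ univ fun x : E => ‖x‖ ^ q := by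
  refine ⟨convex_univ, fun x _ y _ a b ha hb hab => ?_⟩
  have h1 : ‖a • x + b • y‖ ≤ a * ‖x‖ + b * ‖y‖ := by
    refine (norm_add_le _ _).trans_eq ?_
    rw [norm_smul, norm_smul, Real.norm_of_nonneg ha, Real.norm_of_nonneg hb]
  calc ‖a • x + b • y‖ ^ q ≤ (a * ‖x‖ + b * ‖y‖) ^ q :=
        Real.rpow_le_rpow (norm_nonneg _) h1 (by linarith)
    _ ≤ a • ‖x‖ ^ q + b • ‖y‖ ^ q :=
        (convexOn_rpow hq).2 (norm_nonneg x) (norm_nonneg y) ha hb hab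

/-- The defect of midpoint convexity of `x ↦ ‖x‖ ^ q`. -/
def convexDefect {E : Type*} [NormedAddCommGroup E] [NormedSpace ℝ E] (q : ℝ) (a b : E) : ℝ :=
  (‖a‖ ^ q + ‖b‖ ^ q) / 2 - ‖(1 / 2 : ℝ) • (a + b)‖ ^ q

theorem convexDefect_nonneg {E : Type*} [NormedAddCommGroup E] [NormedSpace ℝ E] {q : ℝ}
    (hq : 1 ≤ q) (a b : E) : 0 ≤ convexDefect q a b := by
  have h := (convexOn_norm_rpow (E := E) hq).2 (mem_univ a) (mem_univ b)
    (by norm_num : (0 : ℝ) ≤ 1 / 2) (by norm_num : (0 : ℝ) ≤ 1 / 2) (by norm_num)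
  simp only [smul_eq_mul, ← smul_add] at h
  unfold convexDefect
  linarith

/-- Two sources of strictness: for equal norms the midpoint falls strictly inside the ball, by
strict convexity of the space; for distinct norms t ↦ t^q is strictly convex. -/
theorem convexDefect_pos {E : Type*} [NormedAddCommGroup E] [NormedSpace ℝ E]
    [StrictConvexSpace ℝ E] {q : ℝ} (hq : 1 < q) {a b : E} (hab : a ≠ b) :
    0 < convexDefect q a b := by
  unfold convexDefect
  by_cases hn : ‖a‖ = ‖b‖
  · have h1 : ‖(1 / 2 : ℝ) • (a + b)‖ < ‖a‖ := by
      have := (combo_mem_ball_of_ne (z := (0 : E)) (r := ‖a‖) (a := 1 / 2) (b := 1 / 2)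
        (by simp) (by simp [hn]) hab (by norm_num) (by norm_num) (by norm_num))
      simpa [← smul_add] using this
    have h2 := Real.rpow_lt_rpow (norm_nonneg _) h1 (by linarith : 0 < q)
    rw [← hn]; linarith
  · have h1 := (strictConvexOn_rpow hq).2 (norm_nonneg a) (norm_nonneg b) hn
      (by norm_num : (0 : ℝ) < 1 / 2) (by norm_num : (0 : ℝ) < 1 / 2) (by norm_num)
    simp only [smul_eq_mul] at h1
    have h2 : ‖(1 / 2 : ℝ) • (a + b)‖ ≤ 1 / 2 * ‖a‖ + 1 / 2 * ‖b‖ := by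
      rw [norm_smul, ← mul_add, Real.norm_of_nonneg (by norm_num)]
      gcongr
      exact norm_add_le _ _
    have h3 := Real.rpow_le_rpow (norm_nonneg _) h2 (by linarith : 0 ≤ q)
    linarith

theorem convexDefect_smul {E : Type*} [NormedAddCommGroup E] [NormedSpace ℝ E] {q t : ℝ}
    (ht : 0 ≤ t) (a b : E) : convexDefect q (t • a) (t • b) = t ^ q * convexDefect q a b := by
  unfold convexDefect
  rw [← smul_add, smul_comm, norm_smul t, norm_smul t, norm_smul t, Real.norm_of_nonneg ht,
    Real.mul_rpow ht (norm_nonneg _), Real.mul_rpow ht (norm_nonneg _),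
    Real.mul_rpow ht (norm_nonneg _)]
  ring

/-- Pointwise uniform convexity of `x ↦ ‖x‖ ^ q` on a finite-dimensional strictly convex space. -/
theorem exists_norm_sub_rpow_le {E : Type*} [NormedAddCommGroup E] [NormedSpace ℝ E]
    [StrictConvexSpace ℝ E] [FiniteDimensional ℝ E] {q : ℝ} (hq : 1 < q) {ε : ℝ} (hε : 0 < ε) :
    ∃ C : ℝ, 0 ≤ C ∧ ∀ a b : E,
      ‖a - b‖ ^ q ≤ ε * (‖a‖ ^ q + ‖b‖ ^ q) + C * convexDefect q a b := by
  have hq0 : 0 < q := by linarith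
  have : ProperSpace E := FiniteDimensional.proper_real E
  -- By homogeneity it suffices to treat normalised pairs. Those that are ε-separated form a compact
  -- set, on which the continuous positive defect is bounded below by some δ > 0.
  let K : Set (E × E) := {z | ‖z.1‖ ^ q + ‖z.2‖ ^ q = 1 ∧ ε ≤ ‖z.1 - z.2‖ ^ q}
  have hc1 : Continuous fun z : E × E => ‖z.1‖ ^ q + ‖z.2‖ ^ q :=
    (continuous_fst.norm.rpow_const fun _ => Or.inr hq0.le).add
      (continuous_snd.norm.rpow_const fun _ => Or.inr hq0.le)
  have hc2 : Continuous fun z : E × E => ‖z.1 - z.2‖ ^ q :=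
    (continuous_fst.sub continuous_snd).norm.rpow_const fun _ => Or.inr hq0.le
  have hc3 : Continuous fun z : E × E => convexDefect q z.1 z.2 :=
    (hc1.div_const 2).sub
      (((continuous_fst.add continuous_snd).const_smul (1 / 2 : ℝ)).norm.rpow_const
        fun _ => Or.inr hq0.le)
  have hle : ∀ z : E × E, ‖z.1‖ ^ q + ‖z.2‖ ^ q = 1 → ‖z.1‖ ≤ 1 ∧ ‖z.2‖ ≤ 1 := by
    intro z hz
    have h1 := Real.rpow_nonneg (norm_nonneg z.1) q
    have h2 := Real.rpow_nonneg (norm_nonneg z.2) q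
    constructor <;>
    · rw [← Real.rpow_le_rpow_iff (norm_nonneg _) zero_le_one hq0, Real.one_rpow]
      linarith
  have hK : IsCompact K := by
    refine Metric.isCompact_of_isClosed_isBounded
      ((isClosed_eq hc1 continuous_const).inter (isClosed_le continuous_const hc2)) ?_
    refine (Metric.isBounded_closedBall (x := (0 : E × E)) (r := 1)).subset fun z hz => ?_
    rw [mem_closedBall_zero_iff, Prod.norm_def]
    exact max_le (hle z hz.1).1 (hle z hz.1).2
  obtain ⟨δ, hδ, hδK⟩ := hK.exists_forall_le' hc3.continuousOn (a := 0) fun z hz => by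
    refine convexDefect_pos hq fun h => ?_
    have := hz.2
    rw [h, sub_self, norm_zero, Real.zero_rpow hq0.ne'] at this
    linarith
  -- On `K` both norms are at most 1, so ‖a − b‖^q ≤ 2^q, while the defect is at least δ.
  refine ⟨2 ^ q / δ, by positivity, fun a b => ?_⟩
  have key : ∀ a b : E, ‖a‖ ^ q + ‖b‖ ^ q = 1 →
      ‖a - b‖ ^ q ≤ ε + 2 ^ q / δ * convexDefect q a b := by
    intro a b hab
    have h0 := convexDefect_nonneg hq.le a b
    by_cases h : ε ≤ ‖a - b‖ ^ q
    · have h1 := hδK (a, b) ⟨hab, h⟩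
      have h2 : ‖a - b‖ ≤ 2 := by
        have := hle (a, b) hab
        exact (norm_sub_le _ _).trans (by linarith [this.1, this.2])
      have h3 := Real.rpow_le_rpow (norm_nonneg _) h2 hq0.le
      have h4 : 2 ^ q ≤ 2 ^ q / δ * convexDefect q a b := by
        rw [div_mul_eq_mul_div, le_div_iff₀ hδ]
        gcongr
      linarith
    · have : 0 ≤ 2 ^ q / δ * convexDefect q a b := by positivity
      linarith
  rcases eq_or_lt_of_le (add_nonneg (Real.rpow_nonneg (norm_nonneg a) q)
    (Real.rpow_nonneg (norm_nonneg b) q)) with h | h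
  · have ha : ‖a‖ ^ q = 0 := by
      linarith [Real.rpow_nonneg (norm_nonneg a) q, Real.rpow_nonneg (norm_nonneg b) q]
    have hb : ‖b‖ ^ q = 0 := by
      linarith [Real.rpow_nonneg (norm_nonneg a) q, Real.rpow_nonneg (norm_nonneg b) q]
    rw [Real.rpow_eq_zero (norm_nonneg _) hq0.ne', norm_eq_zero] at ha hb
    have h0 := convexDefect_nonneg hq.le a b
    rw [← h, ha, hb, sub_self, norm_zero, Real.zero_rpow hq0.ne']
    rw [ha, hb] at h0
    positivity
  · set S := ‖a‖ ^ q + ‖b‖ ^ q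
    set t := (S⁻¹) ^ q⁻¹
    have ht : 0 ≤ t := by positivity
    have htq : t ^ q = S⁻¹ := Real.rpow_inv_rpow (by positivity) hq0.ne'
    have hn : ∀ x : E, ‖t • x‖ ^ q = S⁻¹ * ‖x‖ ^ q := fun x => by
      rw [norm_smul, Real.norm_of_nonneg ht, Real.mul_rpow ht (norm_nonneg _), htq]
    have h1 := key (t • a) (t • b) (by rw [hn, hn, ← mul_add, inv_mul_cancel₀ h.ne'])
    rw [← smul_sub, hn, convexDefect_smul ht, htq] at h1
    have h2 := mul_le_mul_of_nonneg_left h1 h.le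
    rw [mul_inv_cancel_left₀ h.ne'] at h2
    calc _ ≤ _ := h2
      _ = _ := by field_simp

/-- Pointwise Fréchet differentiability of `x ↦ ‖x‖ ^ q`, with homogeneous remainder. -/
theorem exists_norm_rpow_remainder_le {E : Type*} [NormedAddCommGroup E] [InnerProductSpace ℝ E]
    [FiniteDimensional ℝ E] {q : ℝ} (hq : 1 < q) {ε : ℝ} (hε : 0 < ε) :
    ∃ C : ℝ, 0 ≤ C ∧ ∀ a h : E,
      |‖a + h‖ ^ q - ‖a‖ ^ q - q * ‖a‖ ^ (q - 2) * inner ℝ a h|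
        ≤ ε * (‖a‖ ^ (q - 1) * ‖h‖) + C * ‖h‖ ^ q := by
  have hq0 : 0 < q := by linarith
  have : ProperSpace E := FiniteDimensional.proper_real E
  set ψ : E → ℝ := fun x => ‖x‖ ^ q
  have hψ : ContDiff ℝ 1 ψ := contDiff_norm_rpow hq
  have hD : ∀ a h : E, fderiv ℝ ψ a h = q * ‖a‖ ^ (q - 2) * inner ℝ a h := fun a h => by
    simp [ψ, fderiv_norm_rpow a hq]
  -- Radius 2 contains every point within distance 1 of the unit sphere, hence the segments from a
  -- unit vector used below, since δ ≤ 1.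
  have huc : UniformContinuousOn (fderiv ℝ ψ) (Metric.closedBall 0 2) :=
    (isCompact_closedBall _ _).uniformContinuousOn_of_continuous
      (hψ.continuous_fderiv one_ne_zero).continuousOn
  obtain ⟨δ', hδ', hδ'c⟩ := Metric.uniformContinuousOn_iff.1 huc ε hε
  set δ := min δ' 1
  have hδ : 0 < δ := lt_min hδ' one_pos
  have unit : ∀ a h : E, ‖a‖ = 1 → ‖h‖ < δ →
      |‖a + h‖ ^ q - ‖a‖ ^ q - q * ‖a‖ ^ (q - 2) * inner ℝ a h| ≤ ε * ‖h‖ := by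
    intro a h ha hh
    have := (convex_ball a δ).norm_image_sub_le_of_norm_fderiv_le' (𝕜 := ℝ) (f := ψ) (C := ε)
      (φ := fderiv ℝ ψ a) (x := a) (y := a + h)
      (fun x _ => (hψ.differentiable one_ne_zero) x) (fun x hx => ?_)
      (Metric.mem_ball_self hδ) (by simpa using hh)
    · rw [add_sub_cancel_left, hD] at this
      exact this
    · rw [Metric.mem_ball] at hx
      rw [← dist_eq_norm]
      refine (hδ'c x ?_ a ?_ (hx.trans_le (min_le_left _ _))).le
      · rw [mem_closedBall_zero_iff]
        have h1 : ‖x‖ ≤ ‖x - a‖ + ‖a‖ := by simpa using norm_add_le (x - a) a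
        rw [← dist_eq_norm, ha] at h1
        have := min_le_right δ' 1
        linarith
      · rw [mem_closedBall_zero_iff, ha]; norm_num
  -- The summands bound the three terms of the remainder when ‖a‖ ≤ δ⁻¹‖h‖. In the opposite case ‖h‖
  -- < δ‖a‖, dividing by ‖a‖ reduces to the unit sphere.
  refine ⟨(δ⁻¹ + 1) ^ q + δ⁻¹ ^ q + q * δ⁻¹ ^ (q - 1), by positivity, fun a h => ?_⟩
  have e1 : 0 ≤ ε * (‖a‖ ^ (q - 1) * ‖h‖) := by positivity
  by_cases hc : ‖h‖ < δ * ‖a‖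
  · have ha : 0 < ‖a‖ := by
      by_contra hcon
      have h0 : ‖a‖ = 0 := le_antisymm (not_lt.1 hcon) (norm_nonneg _)
      rw [h0, mul_zero] at hc
      exact absurd hc (not_lt.2 (norm_nonneg _))
    set s := ‖a‖
    have hu := unit (s⁻¹ • a) (s⁻¹ • h)
      (by rw [norm_smul, norm_inv, Real.norm_of_nonneg ha.le, inv_mul_cancel₀ ha.ne'])
      (by rw [norm_smul, norm_inv, Real.norm_of_nonneg ha.le, inv_mul_lt_iff₀ ha, mul_comm]
          exact hc)
    have hn : ∀ x : E, ‖s⁻¹ • x‖ = s⁻¹ * ‖x‖ := fun x => by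
      rw [norm_smul, norm_inv, Real.norm_of_nonneg ha.le]
    have hsq : s⁻¹ ^ q = (s ^ q)⁻¹ := Real.inv_rpow ha.le _
    rw [← smul_add, hn, hn, hn, real_inner_smul_left, real_inner_smul_right,
      Real.mul_rpow (by positivity) (norm_nonneg _), inv_mul_cancel₀ ha.ne', Real.one_rpow,
      Real.one_rpow, hsq] at hu
    have hsp : 0 < s ^ q := by positivity
    have h2 : s ^ (q - 2) = s ^ q * (s⁻¹ * s⁻¹) := by
      rw [Real.rpow_sub ha, Real.rpow_two]; field_simp
    have h1 : s ^ (q - 1) = s ^ q * s⁻¹ := by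
      rw [Real.rpow_sub ha, Real.rpow_one]; field_simp
    have h3 := mul_le_mul_of_nonneg_left hu hsp.le
    rw [← abs_of_pos hsp, ← abs_mul, abs_of_pos hsp] at h3
    have h4 : s ^ q * ((s ^ q)⁻¹ * ‖a + h‖ ^ q - 1 - q * 1 * (s⁻¹ * (s⁻¹ * inner ℝ a h)))
        = ‖a + h‖ ^ q - s ^ q - q * s ^ (q - 2) * inner ℝ a h := by
      rw [h2]; field_simp
    rw [h4] at h3
    have h5 : 0 ≤ ((δ⁻¹ + 1) ^ q + δ⁻¹ ^ q + q * δ⁻¹ ^ (q - 1)) * ‖h‖ ^ q := by positivity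
    rw [h1]
    calc _ ≤ _ := h3
      _ = ε * (s ^ q * s⁻¹ * ‖h‖) := by ring
      _ ≤ _ := by linarith
  · have ha : ‖a‖ ≤ δ⁻¹ * ‖h‖ := by
      rw [le_inv_mul_iff₀ hδ]; exact not_lt.1 hc
    have b1 : ‖a + h‖ ^ q ≤ (δ⁻¹ + 1) ^ q * ‖h‖ ^ q := by
      rw [← Real.mul_rpow (by positivity) (norm_nonneg _)]
      refine Real.rpow_le_rpow (norm_nonneg _) ?_ hq0.le
      exact (norm_add_le _ _).trans (by linarith)
    have b2 : ‖a‖ ^ q ≤ δ⁻¹ ^ q * ‖h‖ ^ q := by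
      rw [← Real.mul_rpow (by positivity) (norm_nonneg _)]
      exact Real.rpow_le_rpow (norm_nonneg _) ha hq0.le
    have b3 : |q * ‖a‖ ^ (q - 2) * inner ℝ a h| ≤ q * δ⁻¹ ^ (q - 1) * ‖h‖ ^ q := by
      rw [← hD, ← Real.norm_eq_abs]
      refine (ContinuousLinearMap.le_opNorm _ _).trans ?_
      rw [norm_fderiv_norm_id_rpow a hq]
      have h1 : ‖a‖ ^ (q - 1) ≤ δ⁻¹ ^ (q - 1) * ‖h‖ ^ (q - 1) := by
        rw [← Real.mul_rpow (by positivity) (norm_nonneg _)]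
        exact Real.rpow_le_rpow (norm_nonneg _) ha (by linarith)
      have h2 : ‖h‖ ^ q = ‖h‖ ^ (q - 1) * ‖h‖ := by
        nth_rewrite 3 [← Real.rpow_one ‖h‖]
        rw [← Real.rpow_add_of_nonneg (norm_nonneg _) (by linarith) zero_le_one, sub_add_cancel]
      rw [h2]
      calc q * ‖a‖ ^ (q - 1) * ‖h‖ ≤ q * (δ⁻¹ ^ (q - 1) * ‖h‖ ^ (q - 1)) * ‖h‖ := by gcongr
        _ = _ := by ring
    have n1 := Real.rpow_nonneg (norm_nonneg (a + h)) q
    have n2 := Real.rpow_nonneg (norm_nonneg a) q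
    rw [abs_le] at b3 ⊢
    constructor <;> nlinarith [b3.1, b3.2]

/-! ### Differentiability and uniform convexity in L^r; inclusions and functionals -/

section Lp

variable {X : Type*} [MeasurableSpace X] {μ : Measure X}

theorem integrable_norm_rpow_Lp {E : Type*} [NormedAddCommGroup E] {r : ℝ} [hr : Fact (1 < r)]
    (f : Lp E (ENNReal.ofReal r) μ) : Integrable (fun x => ‖f x‖ ^ r) μ := by
  have h0 : 0 < r := zero_lt_one.trans hr.out
  have := (Lp.memLp f).integrable_norm_rpow (by simpa using h0) ENNReal.ofReal_ne_top
  rwa [ENNReal.toReal_ofReal h0.le] at this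

theorem norm_rpow_eq_integral {E : Type*} [NormedAddCommGroup E] {r : ℝ} [hr : Fact (1 < r)]
    (f : Lp E (ENNReal.ofReal r) μ) : ‖f‖ ^ r = ∫ x, ‖f x‖ ^ r ∂μ := by
  have h0 : 0 < r := zero_lt_one.trans hr.out
  have hI : 0 ≤ ∫ x, ‖f x‖ ^ r ∂μ := integral_nonneg fun x => by positivity
  rw [Lp.norm_def, (Lp.memLp f).eLpNorm_eq_integral_rpow_norm (by simpa using h0)
    ENNReal.ofReal_ne_top, ENNReal.toReal_ofReal h0.le, ENNReal.toReal_ofReal (by positivity),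
    Real.rpow_inv_rpow hI h0.ne']

/-- Hölder's inequality with the conjugate exponents r/(r − 1) and r. -/
theorem integrable_norm_rpow_mul_norm {E : Type*} [NormedAddCommGroup E] {r : ℝ}
    [hr : Fact (1 < r)] (f h : Lp E (ENNReal.ofReal r) μ) :
    Integrable (fun x => ‖f x‖ ^ (r - 1) * ‖h x‖) μ ∧
      ∫ x, ‖f x‖ ^ (r - 1) * ‖h x‖ ∂μ ≤ ‖f‖ ^ (r - 1) * ‖h‖ := by
  have h1 : 1 < r := hr.out
  have h0 : 0 < r := zero_lt_one.trans h1
  have hc : (r / (r - 1)).HolderConjugate r := (Real.HolderConjugate.conjExponent h1).symm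
  have hm : MemLp (fun x => ‖f x‖ ^ (r - 1)) (ENNReal.ofReal (r / (r - 1))) μ := by
    have := (Lp.memLp f).norm_rpow_div (ENNReal.ofReal (r - 1))
    rwa [ENNReal.toReal_ofReal (by linarith), ← ENNReal.ofReal_div_of_pos (by linarith)] at this
  have : ENNReal.HolderConjugate (ENNReal.ofReal (r / (r - 1))) (ENNReal.ofReal r) := hc.ennrealOfReal
  refine ⟨MemLp.integrable_mul (p := ENNReal.ofReal (r / (r - 1))) (q := ENNReal.ofReal r)
    hm (Lp.memLp h).norm, ?_⟩
  refine (integral_mul_le_Lp_mul_Lq_of_nonneg hc (ae_of_all _ fun x => by positivity)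
    (ae_of_all _ fun x => by positivity) hm (Lp.memLp h).norm).trans_eq ?_
  have e : ∀ x, (‖f x‖ ^ (r - 1)) ^ (r / (r - 1)) = ‖f x‖ ^ r := fun x => by
    rw [← Real.rpow_mul (norm_nonneg _), mul_div_cancel₀ _ (by linarith)]
  simp only [e]
  rw [← norm_rpow_eq_integral, ← norm_rpow_eq_integral, ← Real.rpow_mul (norm_nonneg _),
    ← Real.rpow_mul (norm_nonneg _), mul_one_div_cancel h0.ne', Real.rpow_one]
  congr 2
  field_simp

theorem abs_norm_rpow_mul_inner_le {E : Type*} [NormedAddCommGroup E] [InnerProductSpace ℝ E]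
    {r : ℝ} (a h : E) :
    |‖a‖ ^ (r - 2) * inner ℝ a h| ≤ ‖a‖ ^ (r - 1) * ‖h‖ := by
  rw [abs_mul, abs_of_nonneg (by positivity)]
  -- The exponent r − 2 may be negative, so adding exponents requires a ≠ 0.
  rcases eq_or_ne a 0 with rfl | ha
  · simp only [inner_zero_left, abs_zero, mul_zero]; positivity
  · calc ‖a‖ ^ (r - 2) * |inner ℝ a h| ≤ ‖a‖ ^ (r - 2) * (‖a‖ * ‖h‖) := by
          gcongr; exact abs_real_inner_le_norm a h
      _ = _ := by
          rw [← mul_assoc]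
          congr 1
          nth_rewrite 2 [← Real.rpow_one ‖a‖]
          rw [← Real.rpow_add (norm_pos_iff.2 ha)]
          congr 1; ring

variable {E : Type*} [NormedAddCommGroup E] [InnerProductSpace ℝ E]

theorem integrable_norm_rpow_mul_inner {r : ℝ} [hr : Fact (1 < r)]
    (f h : Lp E (ENNReal.ofReal r) μ) :
    Integrable (fun x => ‖f x‖ ^ (r - 2) * inner ℝ (f x) (h x)) μ := by
  refine (integrable_norm_rpow_mul_norm f h).1.mono' ?_
    (ae_of_all _ fun x => abs_norm_rpow_mul_inner_le (f x) (h x))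
  exact ((Lp.aestronglyMeasurable f).norm.aemeasurable.pow_const _).aestronglyMeasurable.mul
    (AEStronglyMeasurable.inner (𝕜 := ℝ) (Lp.aestronglyMeasurable f) (Lp.aestronglyMeasurable h))

/-- The derivative of `f ↦ ‖f‖ ^ r` on `L^r`. -/
def normRpowDeriv {r : ℝ} [hr : Fact (1 < r)] (f : Lp E (ENNReal.ofReal r) μ) :
    Lp E (ENNReal.ofReal r) μ →L[ℝ] ℝ :=
  LinearMap.mkContinuous
    { toFun := fun h => r * ∫ x, ‖f x‖ ^ (r - 2) * inner ℝ (f x) (h x) ∂μ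
      map_add' := fun g h => by
        rw [← mul_add, ← integral_add (integrable_norm_rpow_mul_inner f g)
          (integrable_norm_rpow_mul_inner f h)]
        congr 1
        refine integral_congr_ae ((Lp.coeFn_add g h).mono fun x hx => ?_)
        simp only [hx, Pi.add_apply, inner_add_right, mul_add]
      map_smul' := fun c h => by
        rw [RingHom.id_apply, smul_eq_mul, mul_left_comm, ← integral_const_mul c]
        congr 1
        refine integral_congr_ae ((Lp.coeFn_smul (E := E) c h).mono fun x hx => ?_)
        simp only [hx, Pi.smul_apply, real_inner_smul_right]
        ring }
    (r * ‖f‖ ^ (r - 1)) fun h => by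
      have h0 : 0 < r := zero_lt_one.trans hr.out
      change ‖r * ∫ x, ‖f x‖ ^ (r - 2) * inner ℝ (f x) (h x) ∂μ‖ ≤ _
      rw [norm_mul, Real.norm_of_nonneg h0.le, mul_assoc]
      gcongr
      refine le_trans ?_ (integrable_norm_rpow_mul_norm f h).2
      exact norm_integral_le_of_norm_le (integrable_norm_rpow_mul_norm f h).1
        (ae_of_all _ fun x => abs_norm_rpow_mul_inner_le (f x) (h x))

theorem normRpowDeriv_apply {r : ℝ} [hr : Fact (1 < r)] (f h : Lp E (ENNReal.ofReal r) μ) :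
    normRpowDeriv f h = r * ∫ x, ‖f x‖ ^ (r - 2) * inner ℝ (f x) (h x) ∂μ := rfl

/-- The pointwise remainder bound has exactly the homogeneity that survives integration: Hölder
handles its first term and the second integrates to ‖h‖^r. -/
theorem norm_rpow_remainder_Lp_le [FiniteDimensional ℝ E] {r : ℝ} [hr : Fact (1 < r)] {ε C : ℝ}
    (hC : ∀ a h : E, |‖a + h‖ ^ r - ‖a‖ ^ r - r * ‖a‖ ^ (r - 2) * inner ℝ a h|
        ≤ ε * (‖a‖ ^ (r - 1) * ‖h‖) + C * ‖h‖ ^ r) (hε : 0 ≤ ε)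
    (f h : Lp E (ENNReal.ofReal r) μ) :
    |‖f + h‖ ^ r - ‖f‖ ^ r - normRpowDeriv f h|
      ≤ ε * (‖f‖ ^ (r - 1) * ‖h‖) + C * ‖h‖ ^ r := by
  have i1 := integrable_norm_rpow_Lp (f + h)
  have i2 := integrable_norm_rpow_Lp f
  have i3 := (integrable_norm_rpow_mul_inner f h).const_mul r
  have i4 := (integrable_norm_rpow_mul_norm f h).1.const_mul ε
  have i5 := (integrable_norm_rpow_Lp h).const_mul C
  have e : ‖f + h‖ ^ r - ‖f‖ ^ r - normRpowDeriv f h = ∫ x, (‖(f + h) x‖ ^ r - ‖f x‖ ^ r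
      - r * (‖f x‖ ^ (r - 2) * inner ℝ (f x) (h x))) ∂μ := by
    have i12 : Integrable (fun x => ‖(f + h) x‖ ^ r - ‖f x‖ ^ r) μ := i1.sub i2
    rw [integral_sub i12 i3, integral_sub i1 i2, norm_rpow_eq_integral,
      norm_rpow_eq_integral, normRpowDeriv_apply, integral_const_mul]
  rw [e, ← Real.norm_eq_abs]
  calc _ ≤ ∫ x, (ε * (‖f x‖ ^ (r - 1) * ‖h x‖) + C * ‖h x‖ ^ r) ∂μ := by
        refine norm_integral_le_of_norm_le (i4.add i5) ((Lp.coeFn_add f h).mono fun x hx => ?_)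
        rw [hx, Pi.add_apply, ← mul_assoc]
        exact hC (f x) (h x)
    _ = ε * ∫ x, ‖f x‖ ^ (r - 1) * ‖h x‖ ∂μ + C * ‖h‖ ^ r := by
        rw [integral_add i4 i5, integral_const_mul, integral_const_mul, norm_rpow_eq_integral]
    _ ≤ _ := by
        gcongr
        exact (integrable_norm_rpow_mul_norm f h).2

theorem hasFDerivAt_norm_rpow_Lp [FiniteDimensional ℝ E] {r : ℝ} [hr : Fact (1 < r)]
    (f : Lp E (ENNReal.ofReal r) μ) :
    HasFDerivAt (fun g : Lp E (ENNReal.ofReal r) μ => ‖g‖ ^ r) (normRpowDeriv f) f := by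
  have h1 : 1 < r := hr.out
  rw [hasFDerivAt_iff_isLittleO_nhds_zero, Asymptotics.isLittleO_iff]
  intro c hc
  -- Half of the allowed c‖h‖ goes to the linear term, with + 1 guarding against f = 0. The other
  -- half absorbs C‖h‖^r, since ‖h‖^(r−1) → 0 because r > 1.
  obtain ⟨C, hC0, hC⟩ := exists_norm_rpow_remainder_le (E := E) h1
    (ε := c / 2 / (‖f‖ ^ (r - 1) + 1)) (by positivity)
  have ht : Filter.Tendsto (fun h : Lp E (ENNReal.ofReal r) μ => C * ‖h‖ ^ (r - 1)) (nhds 0)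
      (nhds 0) := by
    have hcont : Continuous fun h : Lp E (ENNReal.ofReal r) μ => C * ‖h‖ ^ (r - 1) :=
      (continuous_norm.rpow_const fun _ => Or.inr (by linarith)).const_mul C
    have := hcont.tendsto 0
    rwa [norm_zero, Real.zero_rpow (by linarith), mul_zero] at this
  filter_upwards [ht.eventually (gt_mem_nhds (half_pos hc))] with h hh
  refine (norm_rpow_remainder_Lp_le hC (by positivity) f h).trans ?_
  have e : ‖h‖ ^ r = ‖h‖ ^ (r - 1) * ‖h‖ := by
    nth_rewrite 3 [← Real.rpow_one ‖h‖]
    rw [← Real.rpow_add_of_nonneg (norm_nonneg _) (by linarith) zero_le_one, sub_add_cancel]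
  have h2 : c / 2 / (‖f‖ ^ (r - 1) + 1) * ‖f‖ ^ (r - 1) ≤ c / 2 := by
    rw [div_mul_eq_mul_div, div_le_iff₀ (by positivity)]
    nlinarith
  calc _ = (c / 2 / (‖f‖ ^ (r - 1) + 1) * ‖f‖ ^ (r - 1)) * ‖h‖ + (C * ‖h‖ ^ (r - 1)) * ‖h‖ := by
        rw [e]; ring
    _ ≤ c / 2 * ‖h‖ + c / 2 * ‖h‖ := by gcongr
    _ = c * ‖h‖ := by ring

/-- Additivity of the r-th power of the norm lets the pointwise inequality pass to L^r by
integration, constants included. -/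
theorem convexDefect_Lp_eq {r : ℝ} [hr : Fact (1 < r)] (f g : Lp E (ENNReal.ofReal r) μ) :
    Integrable (fun x => convexDefect r (f x) (g x)) μ ∧
      convexDefect r f g = ∫ x, convexDefect r (f x) (g x) ∂μ := by
  have i1 := ((integrable_norm_rpow_Lp f).add (integrable_norm_rpow_Lp g)).div_const 2
  have i2 := integrable_norm_rpow_Lp ((1 / 2 : ℝ) • (f + g))
  have e : (fun x => convexDefect r (f x) (g x)) =ᵐ[μ]
      fun x => (‖f x‖ ^ r + ‖g x‖ ^ r) / 2 - ‖((1 / 2 : ℝ) • (f + g)) x‖ ^ r := by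
    filter_upwards [Lp.coeFn_add f g, Lp.coeFn_smul (1 / 2 : ℝ) (f + g)] with x h1 h2
    rw [h2, Pi.smul_apply, h1, Pi.add_apply, convexDefect]
  refine ⟨(i1.sub i2).congr e.symm, ?_⟩
  rw [integral_congr_ae e]
  refine Eq.trans ?_ (integral_sub i1 i2).symm
  simp only [Pi.add_apply]
  rw [integral_div, integral_add (integrable_norm_rpow_Lp f) (integrable_norm_rpow_Lp g),
    ← norm_rpow_eq_integral, ← norm_rpow_eq_integral, ← norm_rpow_eq_integral, convexDefect]

/-- Uniform convexity of `L^r`, `1 < r < ∞`. -/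
theorem exists_norm_sub_lt_of_convexDefect_lt [FiniteDimensional ℝ E] {r : ℝ} [hr : Fact (1 < r)]
    (M : ℝ) {ε : ℝ} (hε : 0 < ε) :
    ∃ δ : ℝ, 0 < δ ∧ ∀ f g : Lp E (ENNReal.ofReal r) μ, ‖f‖ ^ r ≤ M → ‖g‖ ^ r ≤ M →
      convexDefect r f g < δ → ‖f - g‖ < ε := by
  have h1 : 1 < r := hr.out
  have h0 : 0 < r := by linarith
  have hεr : 0 < ε ^ r := by positivity
  -- With these constants the two terms are at most ε^r/2 and ε^r/4, strictly below ε^r in total.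
  obtain ⟨C, hC0, hC⟩ := exists_norm_sub_rpow_le (E := E) h1
    (ε := ε ^ r / 4 / (|M| + 1)) (by positivity)
  refine ⟨ε ^ r / 4 / (C + 1), by positivity, fun f g hf hg hd => ?_⟩
  have i1 := ((integrable_norm_rpow_Lp f).add (integrable_norm_rpow_Lp g)).const_mul
    (ε ^ r / 4 / (|M| + 1))
  have i2 := (convexDefect_Lp_eq f g).1.const_mul C
  have key : ‖f - g‖ ^ r ≤ ε ^ r / 4 / (|M| + 1) * (‖f‖ ^ r + ‖g‖ ^ r)
      + C * convexDefect r f g := by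
    rw [norm_rpow_eq_integral f, norm_rpow_eq_integral g, (convexDefect_Lp_eq f g).2,
      ← integral_add (integrable_norm_rpow_Lp f) (integrable_norm_rpow_Lp g),
      ← integral_const_mul, ← integral_const_mul, norm_rpow_eq_integral]
    refine le_trans (integral_mono_ae (integrable_norm_rpow_Lp _) (i1.add i2) ?_)
      (integral_add i1 i2).le
    filter_upwards [Lp.coeFn_sub f g] with x hx
    simp only [hx, Pi.sub_apply, Pi.add_apply]
    exact hC (f x) (g x)
  have b1 : ε ^ r / 4 / (|M| + 1) * (‖f‖ ^ r + ‖g‖ ^ r) ≤ ε ^ r / 2 := by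
    rw [div_mul_eq_mul_div, div_le_iff₀ (by positivity)]
    nlinarith [le_abs_self M]
  have b2 : C * convexDefect r f g ≤ ε ^ r / 4 := by
    calc C * convexDefect r f g ≤ (C + 1) * (ε ^ r / 4 / (C + 1)) := by
          have := convexDefect_nonneg h1.le f g
          gcongr; linarith
      _ = ε ^ r / 4 := by field_simp
  have b3 : ‖f - g‖ ^ r < ε ^ r := by linarith
  exact (Real.rpow_lt_rpow_iff (norm_nonneg _) hε.le h0).1 b3

/-- Almost norm-minimizing selections from a decreasing sequence of convex sets are Cauchy in
`L^r`. -/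
theorem exists_cauchySeq_of_convex [FiniteDimensional ℝ E] {r : ℝ} [hr : Fact (1 < r)]
    {V : Type*} [AddCommGroup V] [Module ℝ V] (T : V →ₗ[ℝ] Lp E (ENNReal.ofReal r) μ)
    {K : ℕ → Set V} (hanti : Antitone K) (hconv : ∀ n, Convex ℝ (K n))
    (hne : ∀ n, (K n).Nonempty) {M : ℝ} (hM : ∀ v ∈ K 0, ‖T v‖ ^ r ≤ M) :
    ∃ w : ℕ → V, (∀ n, w n ∈ K n) ∧ CauchySeq fun n => T (w n) := by
  set d : ℕ → ℝ := fun n => sInf ((fun v => ‖T v‖ ^ r) '' K n)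
  have hbdd : ∀ n, BddBelow ((fun v => ‖T v‖ ^ r) '' K n) := fun n =>
    ⟨0, by rintro _ ⟨v, _, rfl⟩; positivity⟩
  have hd : ∀ n, ∀ v ∈ K n, d n ≤ ‖T v‖ ^ r := fun n v hv => csInf_le (hbdd n) ⟨v, hv, rfl⟩
  have hmono : Monotone d := fun m n hmn =>
    csInf_le_csInf (hbdd m) ((hne n).image _) (image_mono (hanti hmn))
  have hdM : BddAbove (range d) := by
    refine ⟨M, ?_⟩
    rintro _ ⟨n, rfl⟩
    obtain ⟨v, hv⟩ := hne n
    exact (hd n v hv).trans (hM v (hanti (Nat.zero_le n) hv))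
  have hex : ∀ n, ∃ v ∈ K n, ‖T v‖ ^ r < d n + 1 / ((n : ℝ) + 1) := by
    intro n
    obtain ⟨_, ⟨v, hv, rfl⟩, h⟩ := exists_lt_of_csInf_lt ((hne n).image fun v => ‖T v‖ ^ r)
      (lt_add_of_pos_right (d n) (Nat.one_div_pos_of_nat (n := n)))
    exact ⟨v, hv, h⟩
  choose w hw hwd using hex
  refine ⟨w, hw, ?_⟩
  have hlim := tendsto_atTop_ciSup hmono hdM
  set D := ⨆ n, d n
  rw [Metric.cauchySeq_iff']
  intro ε hε
  obtain ⟨δ, hδ, hδc⟩ := exists_norm_sub_lt_of_convexDefect_lt (μ := μ) (E := E) (r := r) M hε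
  -- For m ≥ n the midpoint of `w m` and `w n` is in `K n`, so its value is at least `d n`. The mean
  -- of the endpoint values is below (D + d n)/2 + 1/(n+1). The displayed quantity thus bounds the
  -- defect.
  have hlim2 : Filter.Tendsto (fun n : ℕ => (D - d n) / 2 + 1 / ((n : ℝ) + 1)) Filter.atTop
      (nhds 0) := by
    have := ((tendsto_const_nhds (x := D)).sub hlim).div_const 2
    simpa using this.add tendsto_one_div_add_atTop_nhds_zero_nat
  obtain ⟨n, hn⟩ := (hlim2.eventually (gt_mem_nhds hδ)).exists
  refine ⟨n, fun m hm => ?_⟩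
  rw [dist_eq_norm]
  have hwm : w m ∈ K n := hanti hm (hw m)
  refine hδc _ _ (hM _ (hanti (Nat.zero_le m) (hw m))) (hM _ (hanti (Nat.zero_le n) (hw n))) ?_
  have hmid : (1 / 2 : ℝ) • (w m + w n) ∈ K n := by
    rw [smul_add]
    exact hconv n hwm (hw n) (by norm_num) (by norm_num) (by norm_num)
  have h1 := hd n _ hmid
  rw [map_smul, map_add] at h1
  have h2 := hwd m
  have h3 := hwd n
  have h4 : d m ≤ D := le_ciSup hdM m
  have h5 : 1 / ((m : ℝ) + 1) ≤ 1 / ((n : ℝ) + 1) := Nat.one_div_le_one_div hm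
  unfold convexDefect
  linarith

/-- The inclusion `L^q ⊆ L^p`, `p ≤ q`, over a finite measure space. -/
def inclLp {F : Type*} [NormedAddCommGroup F] [NormedSpace ℝ F] [IsFiniteMeasure μ] {p q : ℝ≥0∞}
    [Fact (1 ≤ p)] [Fact (1 ≤ q)] (h : p ≤ q) : Lp F q μ →L[ℝ] Lp F p μ :=
  LinearMap.mkContinuous
    { toFun := fun f => ((Lp.memLp f).mono_exponent h).toLp f
      map_add' := fun f g => by
        rw [← MemLp.toLp_add]
        exact MemLp.toLp_congr _ _ (Lp.coeFn_add f g)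
      map_smul' := fun c f => by
        rw [RingHom.id_apply, ← MemLp.toLp_const_smul]
        exact MemLp.toLp_congr _ _ (Lp.coeFn_smul c f) }
    ((μ univ ^ (1 / p.toReal - 1 / q.toReal)).toReal) fun f => by
      change ‖((Lp.memLp f).mono_exponent h).toLp f‖ ≤ _
      rw [Lp.norm_toLp, Lp.norm_def, ← ENNReal.toReal_mul, mul_comm]
      rcases eq_or_ne μ 0 with h0 | h0
      · subst h0; simp
      · refine ENNReal.toReal_mono (ENNReal.mul_ne_top (Lp.eLpNorm_ne_top f) ?_)
          (eLpNorm_le_eLpNorm_mul_rpow_measure_univ h (Lp.aestronglyMeasurable f))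
        have : μ univ ≠ 0 := by simpa using h0
        exact ENNReal.rpow_ne_top_of_ne_zero this (measure_ne_top μ _)

theorem inclLp_coeFn {F : Type*} [NormedAddCommGroup F] [NormedSpace ℝ F] [IsFiniteMeasure μ]
    {p q : ℝ≥0∞} [Fact (1 ≤ p)] [Fact (1 ≤ q)] (h : p ≤ q) (f : Lp F q μ) :
    inclLp h f =ᵐ[μ] f :=
  MemLp.coeFn_toLp ((Lp.memLp f).mono_exponent h)

/-- The functional `u ↦ ∫ u k` on `L^q` of a finite measure space, for bounded `k`. -/
def integralMul [IsFiniteMeasure μ] {q : ℝ≥0∞} [hq : Fact (1 ≤ q)] (k : X → ℝ) (M : ℝ)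
    (hk : AEStronglyMeasurable k μ) (hM : ∀ x, ‖k x‖ ≤ M) : Lp ℝ q μ →L[ℝ] ℝ :=
  (LinearMap.mkContinuous
    { toFun := fun f : Lp ℝ 1 μ => ∫ x, f x * k x ∂μ
      map_add' := fun f g => by
        rw [← integral_add ((L1.integrable_coeFn f).mul_bdd hk (ae_of_all _ hM))
          ((L1.integrable_coeFn g).mul_bdd hk (ae_of_all _ hM))]
        refine integral_congr_ae ((Lp.coeFn_add f g).mono fun x hx => ?_)
        simp only [hx, Pi.add_apply, add_mul]
      map_smul' := fun c f => by
        rw [RingHom.id_apply, smul_eq_mul, ← integral_const_mul]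
        refine integral_congr_ae ((Lp.coeFn_smul c f).mono fun x hx => ?_)
        simp only [hx, Pi.smul_apply, smul_eq_mul, mul_assoc] }
    M fun f => by
      change ‖∫ x, f x * k x ∂μ‖ ≤ _
      rw [L1.norm_eq_integral_norm, ← integral_const_mul]
      refine norm_integral_le_of_norm_le ((L1.integrable_coeFn f).norm.const_mul M)
        (ae_of_all _ fun x => ?_)
      rw [norm_mul, mul_comm]
      gcongr
      exact hM x).comp (inclLp hq.out)

theorem integralMul_apply [IsFiniteMeasure μ] {q : ℝ≥0∞} [hq : Fact (1 ≤ q)] (k : X → ℝ) (M : ℝ)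
    (hk : AEStronglyMeasurable k μ) (hM : ∀ x, ‖k x‖ ≤ M) (f : Lp ℝ q μ) :
    integralMul k M hk hM f = ∫ x, f x * k x ∂μ :=
  integral_congr_ae ((inclLp_coeFn hq.out f).mono fun x hx => congrArg (· * k x) hx)

end Lp

/-! ### Test functions and closedness of the Sobolev spaces -/

theorem IsTestFunction.eq_zero_of_notMem {N : ℕ} {Ω : Set (EuclideanSpace ℝ (Fin N))}
    {f : EuclideanSpace ℝ (Fin N) → ℝ} (hf : IsTestFunction Ω f) {x : EuclideanSpace ℝ (Fin N)}
    (hx : x ∉ Ω) : f x = 0 :=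
  image_eq_zero_of_notMem_tsupport fun h => hx (hf.tsupport_subset h)

theorem IsTestFunction.continuous_fderiv_apply {N : ℕ} {Ω : Set (EuclideanSpace ℝ (Fin N))}
    {f : EuclideanSpace ℝ (Fin N) → ℝ} (hf : IsTestFunction Ω f) (v : EuclideanSpace ℝ (Fin N)) :
    Continuous fun x => fderiv ℝ f x v :=
  (hf.contDiff.continuous_fderiv (by simp)).clm_apply continuous_const

/-- Both integrands vanish off Ω, so this is integration by parts on the whole space, without
boundary terms. -/
theorem IsTestFunction.setIntegral_mul_fderiv {N : ℕ} {Ω : Set (EuclideanSpace ℝ (Fin N))}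
    {f g : EuclideanSpace ℝ (Fin N) → ℝ} (hf : IsTestFunction Ω f) (hg : IsTestFunction Ω g)
    (v : EuclideanSpace ℝ (Fin N)) :
    ∫ x in Ω, f x * fderiv ℝ g x v = -∫ x in Ω, fderiv ℝ f x v * g x := by
  have i1 : Integrable (fun x => fderiv ℝ f x v * g x) volume :=
    ((hf.continuous_fderiv_apply v).mul hg.contDiff.continuous).integrable_of_hasCompactSupport
      hg.hasCompactSupport.mul_left
  have i2 : Integrable (fun x => f x * fderiv ℝ g x v) volume :=
    (hf.contDiff.continuous.mul (hg.continuous_fderiv_apply v)).integrable_of_hasCompactSupport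
      hf.hasCompactSupport.mul_right
  have i3 : Integrable (fun x => f x * g x) volume :=
    (hf.contDiff.continuous.mul hg.contDiff.continuous).integrable_of_hasCompactSupport
      hg.hasCompactSupport.mul_left
  have hparts := integral_mul_fderiv_eq_neg_fderiv_mul_of_integrable i1 i2 i3
    (fun x _ => (hf.contDiff.differentiable (by simp)) x)
    (fun x _ => (hg.contDiff.differentiable (by simp)) x)
  rw [setIntegral_eq_integral_of_forall_compl_eq_zero fun x hx => by
      rw [hf.eq_zero_of_notMem hx, zero_mul],
    setIntegral_eq_integral_of_forall_compl_eq_zero fun x hx => by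
      rw [hg.eq_zero_of_notMem hx, mul_zero], hparts]

/-- Each test function and direction imposes an equality between continuous linear functionals of
the pair. -/
theorem isClosed_sobolev {N : ℕ} (r : ℝ) [Fact (1 < r)] (Ω : Set (EuclideanSpace ℝ (Fin N)))
    [IsFiniteMeasure (volume.restrict Ω)] :
    IsClosed (sobolev r Ω : Set (Lp ℝ (ENNReal.ofReal r) (volume.restrict Ω) ×
      Lp (EuclideanSpace ℝ (Fin N)) (ENNReal.ofReal r) (volume.restrict Ω))) := by
  change IsClosed {w : Lp ℝ (ENNReal.ofReal r) (volume.restrict Ω) ×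
      Lp (EuclideanSpace ℝ (Fin N)) (ENNReal.ofReal r) (volume.restrict Ω) |
      IsWeakGradient Ω w.1 w.2}
  simp only [IsWeakGradient, ofPred_forall]
  refine isClosed_iInter fun f => isClosed_iInter fun hf => isClosed_iInter fun v => ?_
  have hd := hf.continuous_fderiv_apply v
  have hdc : HasCompactSupport fun x => fderiv ℝ f x v :=
    hf.hasCompactSupport.fderiv_apply (𝕜 := ℝ) v
  obtain ⟨M, hM⟩ := hd.bounded_above_of_compact_support hdc
  obtain ⟨M', hM'⟩ := hf.contDiff.continuous.bounded_above_of_compact_support hf.hasCompactSupport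
  let φ : Lp ℝ (ENNReal.ofReal r) (volume.restrict Ω) →L[ℝ] ℝ :=
    integralMul _ M hd.aestronglyMeasurable hM
  let χ : Lp (EuclideanSpace ℝ (Fin N)) (ENNReal.ofReal r) (volume.restrict Ω) →L[ℝ] ℝ :=
    (integralMul _ M' hf.contDiff.continuous.aestronglyMeasurable hM').comp
      ((innerSL ℝ v).compLpL (ENNReal.ofReal r) (volume.restrict Ω))
  have e1 : ∀ w, φ w = ∫ x in Ω, w x * fderiv ℝ f x v := fun w => integralMul_apply _ _ _ _ w
  have e2 : ∀ w, χ w = ∫ x in Ω, inner ℝ (w x) v * f x := fun w => by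
    refine (integralMul_apply _ M' hf.contDiff.continuous.aestronglyMeasurable hM' _).trans ?_
    refine integral_congr_ae (((innerSL ℝ v).coeFn_compLpL w).mono fun x hx => ?_)
    have hx' : _ = inner ℝ v (w x) := hx
    exact congrArg (· * f x) (hx'.trans (real_inner_comm _ _))
  simp only [← e1, ← e2]
  exact isClosed_eq (φ.continuous.comp continuous_fst) (χ.continuous.comp continuous_snd).neg

/-- `W^{1,r}_0(Ω)` as a subspace of `L^r(Ω) × L^r(Ω; ℝ^N)`. -/
def sobolevZeroProd {N : ℕ} (r : ℝ) [Fact (1 < r)] (Ω : Set (EuclideanSpace ℝ (Fin N))) :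
    Submodule ℝ (Lp ℝ (ENNReal.ofReal r) (volume.restrict Ω) ×
      Lp (EuclideanSpace ℝ (Fin N)) (ENNReal.ofReal r) (volume.restrict Ω)) where
  carrier := {w | ∃ u : sobolevZero r Ω, u.1.1 = w}
  zero_mem' := ⟨0, rfl⟩
  add_mem' := by
    rintro _ _ ⟨u, rfl⟩ ⟨v, rfl⟩
    exact ⟨u + v, rfl⟩
  smul_mem' := by
    rintro c _ ⟨u, rfl⟩
    exact ⟨c • u, rfl⟩

theorem mem_sobolevZeroProd {N : ℕ} {r : ℝ} [Fact (1 < r)] {Ω : Set (EuclideanSpace ℝ (Fin N))}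
    {w : Lp ℝ (ENNReal.ofReal r) (volume.restrict Ω) ×
      Lp (EuclideanSpace ℝ (Fin N)) (ENNReal.ofReal r) (volume.restrict Ω)} :
    w ∈ sobolevZeroProd r Ω ↔ ∃ u : sobolevZero r Ω, u.1.1 = w := Iff.rfl

theorem isClosed_coe_image_closure {Y : Type*} [AddCommMonoid Y] [Module ℝ Y] [TopologicalSpace Y]
    {S : Submodule ℝ Y} (hS : IsClosed (S : Set Y)) (t : Set S) :
    IsClosed {y : Y | ∃ v : S, v ∈ closure t ∧ v.1 = y} :=
  hS.isClosedEmbedding_subtypeVal.isClosedMap _ isClosed_closure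

/-- Closedness in the ambient product, rather than in the Sobolev space, is what keeps limits built
in L^r × L^r inside W^{1,r}_0. -/
theorem isClosed_sobolevZeroProd {N : ℕ} (r : ℝ) [Fact (1 < r)]
    (Ω : Set (EuclideanSpace ℝ (Fin N))) [IsFiniteMeasure (volume.restrict Ω)] :
    IsClosed (sobolevZeroProd r Ω : Set (Lp ℝ (ENNReal.ofReal r) (volume.restrict Ω) ×
      Lp (EuclideanSpace ℝ (Fin N)) (ENNReal.ofReal r) (volume.restrict Ω))) := by
  have h1 := isClosed_coe_image_closure (isClosed_sobolev r Ω) (testSubspace r Ω)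
  have e1 : ∀ u : sobolevZero r Ω, u.1 ∈ closure (testSubspace r Ω : Set (sobolev r Ω)) :=
    fun u => u.2
  have e2 : ∀ v : sobolev r Ω, v ∈ closure (testSubspace r Ω : Set (sobolev r Ω)) →
      v ∈ sobolevZero r Ω := fun v h => h
  have e : {y | ∃ v : sobolev r Ω, v ∈ closure (testSubspace r Ω : Set (sobolev r Ω)) ∧ v.1 = y}
      = (sobolevZeroProd r Ω : Set (Lp ℝ (ENNReal.ofReal r) (volume.restrict Ω) ×
        Lp (EuclideanSpace ℝ (Fin N)) (ENNReal.ofReal r) (volume.restrict Ω))) := by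
    ext w
    constructor
    · rintro ⟨v, hv, h⟩
      exact ⟨⟨v, e2 v hv⟩, h⟩
    · rintro ⟨u, hu⟩
      exact ⟨u.1, e1 u, hu⟩
  rw [← e]
  exact h1

/-! ### Translation estimate and Poincaré's inequality -/

theorem lintegral_rpow_le_of_isProbabilityMeasure {X : Type*} [MeasurableSpace X] (μ : Measure X)
    [IsProbabilityMeasure μ] {g : X → ℝ≥0∞} (hg : AEMeasurable g μ) {q : ℝ} (hq : 1 ≤ q) :
    (∫⁻ x, g x ∂μ) ^ q ≤ ∫⁻ x, g x ^ q ∂μ := by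
  have h := eLpNorm'_le_eLpNorm'_of_exponent_le zero_lt_one hq μ hg.aestronglyMeasurable
  simp only [eLpNorm', enorm_eq_self, ENNReal.rpow_one, one_div, inv_one] at h
  rwa [ENNReal.le_rpow_inv_iff (by linarith)] at h

/-- The translation estimate `‖f(· + h) - f‖_q ≤ ‖h‖ ‖Df‖_q`. -/
theorem lintegral_enorm_translate_sub_rpow_le {E : Type*} [NormedAddCommGroup E] [NormedSpace ℝ E]
    [MeasurableSpace E] [BorelSpace E] [SecondCountableTopology E] (μ : Measure E) [SFinite μ]
    [μ.IsAddRightInvariant]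
    {f : E → ℝ} (hf : ContDiff ℝ 1 f) {q : ℝ} (hq : 1 ≤ q) (h : E) :
    ∫⁻ x, ‖f (x + h) - f x‖ₑ ^ q ∂μ ≤ ‖h‖ₑ ^ q * ∫⁻ x, ‖fderiv ℝ f x‖ₑ ^ q ∂μ := by
  have hdc : Continuous (fderiv ℝ f) := hf.continuous_fderiv one_ne_zero
  have : IsProbabilityMeasure (volume.restrict (Ioc (0 : ℝ) 1)) := ⟨by simp⟩
  -- The fundamental theorem of calculus on the segment from x to x + h, then Jensen on the unit
  -- interval. Integrating in x, each t contributes equally by translation invariance.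
  have hpt : ∀ x, ‖f (x + h) - f x‖ₑ ^ q
      ≤ ‖h‖ₑ ^ q * ∫⁻ t in Ioc (0 : ℝ) 1, ‖fderiv ℝ f (x + t • h)‖ₑ ^ q := by
    intro x
    have hc : Continuous fun t : ℝ => fderiv ℝ f (x + t • h) h := by fun_prop
    have hc2 : Continuous fun t : ℝ => ‖fderiv ℝ f (x + t • h)‖ₑ := by fun_prop
    have h1 : ∫ t in (0 : ℝ)..1, fderiv ℝ f (x + t • h) h = f (x + h) - f x := by
      have := intervalIntegral.integral_eq_sub_of_hasDerivAt (a := 0) (b := 1)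
        (f := fun t : ℝ => f (x + t • h)) (f' := fun t => fderiv ℝ f (x + t • h) h)
        (fun t _ => ?_) (hc.intervalIntegrable _ _)
      · simpa using this
      · have hl : HasDerivAt (fun t : ℝ => x + t • h) h t := by
          simpa using ((hasDerivAt_id t).smul_const h).const_add x
        exact ((hf.differentiable one_ne_zero) _).hasFDerivAt.comp_hasDerivAt t hl
    rw [← h1, intervalIntegral.integral_of_le zero_le_one]
    calc _ ≤ (∫⁻ t in Ioc (0 : ℝ) 1, ‖fderiv ℝ f (x + t • h)‖ₑ * ‖h‖ₑ) ^ q := by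
          gcongr
          refine (enorm_integral_le_lintegral_enorm _).trans ?_
          exact lintegral_mono fun t => ContinuousLinearMap.le_opENorm _ _
      _ = ‖h‖ₑ ^ q * (∫⁻ t in Ioc (0 : ℝ) 1, ‖fderiv ℝ f (x + t • h)‖ₑ) ^ q := by
          rw [lintegral_mul_const _ hc2.measurable, mul_comm,
            ENNReal.mul_rpow_of_nonneg _ _ (by linarith)]
      _ ≤ _ := by
          gcongr
          exact lintegral_rpow_le_of_isProbabilityMeasure _ hc2.measurable.aemeasurable hq
  refine (lintegral_mono hpt).trans ?_
  have hm : Measurable (Function.uncurry fun (x : E) (t : ℝ) => ‖fderiv ℝ f (x + t • h)‖ₑ ^ q) := by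
    have : Continuous fun z : E × ℝ => ‖fderiv ℝ f (z.1 + z.2 • h)‖ₑ := by fun_prop
    exact this.measurable.pow_const q
  rw [lintegral_const_mul' _ _ (ENNReal.rpow_ne_top_of_nonneg (by linarith) enorm_ne_top),
     lintegral_lintegral_swap hm.aemeasurable]
  gcongr
  refine (lintegral_congr fun t => ?_).trans_le
    (le_of_eq (b := ∫⁻ _ in Ioc (0 : ℝ) 1, ∫⁻ x, ‖fderiv ℝ f x‖ₑ ^ q ∂μ) rfl) |>.trans ?_
  · exact lintegral_add_right_eq_self (fun x => ‖fderiv ℝ f x‖ₑ ^ q) (t • h)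
  · simp

/-- Uniqueness of the weak gradient: the fundamental lemma of the calculus of variations in each
direction, then finitely many null sets for an orthonormal basis. -/
theorem fderiv_eq_of_isWeakGradient {N : ℕ} {r : ℝ} [hr : Fact (1 < r)]
    {Ω : Set (EuclideanSpace ℝ (Fin N))} (hΩ : IsOpen Ω)
    {f : EuclideanSpace ℝ (Fin N) → ℝ} (hf : IsTestFunction Ω f)
    {u : EuclideanSpace ℝ (Fin N) → ℝ}
    {G : EuclideanSpace ℝ (Fin N) → EuclideanSpace ℝ (Fin N)}
    (hG : MemLp G (ENNReal.ofReal r) (volume.restrict Ω)) (huG : IsWeakGradient Ω u G)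
    (huf : u =ᵐ[volume.restrict Ω] f) :
    ∀ᵐ x ∂(volume.restrict Ω), fderiv ℝ f x = innerSL ℝ (G x) := by
  have key : ∀ v : EuclideanSpace ℝ (Fin N), ∀ᵐ x ∂(volume.restrict Ω),
      fderiv ℝ f x v - inner ℝ (G x) v = 0 := by
    intro v
    have hd := hf.continuous_fderiv_apply v
    have hli : LocallyIntegrable (fun x => fderiv ℝ f x v - inner ℝ (G x) v)
        (volume.restrict Ω) :=
      hd.locallyIntegrable.sub ((hG.inner_const v).locallyIntegrable Fact.out)
    have := hΩ.ae_eq_zero_of_integral_contDiff_smul_eq_zero (hli.locallyIntegrableOn Ω)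
      fun g hg hgc hgs => ?_
    · filter_upwards [this, ae_restrict_mem hΩ.measurableSet] with x hx hxΩ using hx hxΩ
    have hgt : IsTestFunction Ω g := ⟨hg, hgc, hgs⟩
    have i1 : Integrable (fun x => fderiv ℝ f x v * g x) volume :=
      (hd.mul hg.continuous).integrable_of_hasCompactSupport hgc.mul_left
    have hparts := hf.setIntegral_mul_fderiv hgt v
    have e3 : ∫ x in Ω, u x * fderiv ℝ g x v = ∫ x in Ω, f x * fderiv ℝ g x v :=
      integral_congr_ae (huf.mono fun x hx => congrArg (· * fderiv ℝ g x v) hx)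
    have hw := huG g hgt v
    have i4 := integrable_mul_of_compact Ω (hG.inner_const v) hg.continuous hgc
    have i5 : ∫ x in Ω, g x • (fderiv ℝ f x v - inner ℝ (G x) v)
        = ∫ x in Ω, (fderiv ℝ f x v * g x - inner ℝ (G x) v * g x) := by
      congr 1; ext x; rw [smul_eq_mul]; ring
    rw [i5, integral_sub i1.restrict i4]
    linarith
  have hall : ∀ᵐ x ∂(volume.restrict Ω), ∀ i : Fin N,
      fderiv ℝ f x (EuclideanSpace.basisFun (Fin N) ℝ i)
        - inner ℝ (G x) (EuclideanSpace.basisFun (Fin N) ℝ i) = 0 :=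
    ae_all_iff.2 fun i => key _
  filter_upwards [hall] with x hx
  have : (fderiv ℝ f x : EuclideanSpace ℝ (Fin N) →ₗ[ℝ] ℝ) = innerSL ℝ (G x) := by
    refine (EuclideanSpace.basisFun (Fin N) ℝ).toBasis.ext fun i => ?_
    have := hx i
    rw [OrthonormalBasis.coe_toBasis]
    simpa [sub_eq_zero] using this
  exact ContinuousLinearMap.coe_injective this

theorem enorm_rpow_eq_lintegral {X F : Type*} [MeasurableSpace X] {μ : Measure X}
    [NormedAddCommGroup F] {r : ℝ} [hr : Fact (1 < r)] (f : Lp F (ENNReal.ofReal r) μ) :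
    ‖f‖ₑ ^ r = ∫⁻ x, ‖f x‖ₑ ^ r ∂μ := by
  have h0 : 0 < r := zero_lt_one.trans hr.out
  rw [Lp.enorm_def, eLpNorm_eq_lintegral_rpow_enorm_toReal (by simpa using h0)
    ENNReal.ofReal_ne_top, ENNReal.toReal_ofReal h0.le, one_div, ENNReal.rpow_inv_rpow h0.ne']

theorem lintegral_enorm_fderiv_rpow_eq {N : ℕ} {r : ℝ} [hr : Fact (1 < r)]
    {Ω : Set (EuclideanSpace ℝ (Fin N))} (hΩ : IsOpen Ω)
    {f : EuclideanSpace ℝ (Fin N) → ℝ} (hf : IsTestFunction Ω f) (w : sobolev r Ω)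
    (hwf : w.1.1 =ᵐ[volume.restrict Ω] f) :
    ∫⁻ x, ‖fderiv ℝ f x‖ₑ ^ r = ‖w.1.2‖ₑ ^ r := by
  have h0 : 0 < r := zero_lt_one.trans hr.out
  rw [enorm_rpow_eq_lintegral, ← setLIntegral_eq_of_support_subset (s := Ω)]
  · refine lintegral_congr_ae ?_
    filter_upwards [fderiv_eq_of_isWeakGradient hΩ hf (Lp.memLp w.1.2) w.2 hwf] with x hx
    rw [hx, ← ofReal_norm, innerSL_apply_norm, ofReal_norm]
  · intro x hx
    refine hf.tsupport_subset (support_fderiv_subset ℝ fun h => hx ?_)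
    change ‖fderiv ℝ f x‖ₑ ^ r = 0
    rw [← ofReal_norm, h, norm_zero, ENNReal.ofReal_zero, ENNReal.zero_rpow_of_pos h0]

/-- Density of test functions: the Poincaré and cube estimates are closed conditions, so they need
only be checked for smooth functions. -/
theorem sobolevZero_induction {N : ℕ} {r : ℝ} [Fact (1 < r)]
    {Ω : Set (EuclideanSpace ℝ (Fin N))} {P : sobolev r Ω → Prop}
    (hP : IsClosed {w | P w})
    (h : ∀ w : sobolev r Ω, ∀ f, IsTestFunction Ω f → w.1.1 =ᵐ[volume.restrict Ω] f → P w)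
    (u : sobolevZero r Ω) : P u.1 :=
  closure_minimal (s := (testSubspace r Ω : Set (sobolev r Ω)))
    (fun w ⟨f, hf, hwf⟩ => h w f hf hwf) hP u.2

/-- **Poincaré's inequality** on `W^{1,r}_0(Ω)`. -/
theorem exists_norm_le_norm_grad {N : ℕ} (hN : 1 ≤ N) (r : ℝ) [hr : Fact (1 < r)]
    {Ω : Set (EuclideanSpace ℝ (Fin N))} (hΩ : IsOpen Ω) (hb : Bornology.IsBounded Ω) :
    ∃ K : ℝ, ∀ u : sobolevZero r Ω, ‖u.1.1.1‖ ≤ K * ‖u.1.1.2‖ := by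
  have h0 : 0 < r := zero_lt_one.trans hr.out
  obtain ⟨R, hR⟩ := hb.subset_closedBall 0
  have : Nonempty (Fin N) := ⟨⟨0, hN⟩⟩
  -- A vector longer than the diameter moves Ω off itself. Then f(x + h) = 0 for x in Ω, and the
  -- translation estimate bounds f itself.
  obtain ⟨h, hh⟩ := exists_norm_eq (EuclideanSpace ℝ (Fin N)) (c := 2 * |R| + 1) (by positivity)
  have hout : ∀ x ∈ Ω, x + h ∉ Ω := by
    intro x hx hxh
    have h1 := hR hx
    have h2 := hR hxh
    rw [mem_closedBall_zero_iff] at h1 h2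
    have h3 : ‖h‖ ≤ ‖x + h‖ + ‖x‖ := by simpa using norm_sub_le (x + h) x
    have := le_abs_self R
    linarith
  refine ⟨‖h‖, sobolevZero_induction (P := fun w => ‖w.1.1‖ ≤ ‖h‖ * ‖w.1.2‖) ?_ ?_⟩
  · exact isClosed_le (continuous_fst.comp continuous_subtype_val).norm
      ((continuous_snd.comp continuous_subtype_val).norm.const_mul _)
  intro w f hf hwf
  have h1 : ‖w.1.1‖ₑ ^ r ≤ (‖h‖ₑ * ‖w.1.2‖ₑ) ^ r := by
    rw [enorm_rpow_eq_lintegral, ENNReal.mul_rpow_of_nonneg _ _ h0.le,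
      ← lintegral_enorm_fderiv_rpow_eq hΩ hf w hwf]
    refine le_trans ?_ (lintegral_enorm_translate_sub_rpow_le volume
      (hf.contDiff.of_le (by simp)) hr.out.le h)
    refine le_trans (lintegral_mono_ae ?_) (setLIntegral_le_lintegral Ω _)
    filter_upwards [hwf, ae_restrict_mem hΩ.measurableSet] with x hx hxΩ
    rw [hx, hf.eq_zero_of_notMem (hout x hxΩ), zero_sub, enorm_neg]
  rw [ENNReal.rpow_le_rpow_iff h0] at h1
  have h2 := ENNReal.toReal_mono (ENNReal.mul_ne_top enorm_ne_top enorm_ne_top) h1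
  simpa [ENNReal.toReal_mul] using h2

/-! ### Compactness by averaging over cubes (Rellich-Kondrachov) -/

/-- The index of the cube of the grid of mesh `δ` containing `x`. -/
def cell {N : ℕ} (δ : ℝ) (x : EuclideanSpace ℝ (Fin N)) : Fin N → ℤ := fun i => ⌊x i / δ⌋

theorem measurable_cell {N : ℕ} (δ : ℝ) :
    Measurable (cell δ : EuclideanSpace ℝ (Fin N) → Fin N → ℤ) :=
  measurable_pi_iff.2 fun i =>
    Int.measurable_floor.comp ((by fun_prop : Continuous fun x : EuclideanSpace ℝ (Fin N) =>
      x i / δ).measurable)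

/-- The cube of the grid of mesh `δ` with index `k`. -/
def cube {N : ℕ} (δ : ℝ) (k : Fin N → ℤ) : Set (EuclideanSpace ℝ (Fin N)) := cell δ ⁻¹' {k}

theorem measurableSet_cube {N : ℕ} (δ : ℝ) (k : Fin N → ℤ) : MeasurableSet (cube δ k) :=
  measurable_cell δ (measurableSet_singleton k)

theorem volume_cube {N : ℕ} {δ : ℝ} (hδ : 0 < δ) (k : Fin N → ℤ) :
    volume (cube δ k) = ENNReal.ofReal (δ ^ N) := by
  have e : cube δ k = WithLp.ofLp ⁻¹' (univ.pi fun i => Ico (k i * δ) ((k i + 1) * δ)) := by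
    ext x
    simp only [cube, mem_preimage, mem_singleton_iff, mem_univ_pi, mem_Ico, funext_iff, cell,
      Int.floor_eq_iff, le_div_iff₀ hδ, div_lt_iff₀ hδ]
  rw [e, (PiLp.volume_preserving_ofLp (Fin N)).measure_preimage
    (MeasurableSet.univ_pi fun i => measurableSet_Ico).nullMeasurableSet, Real.volume_pi_Ico]
  have : ∀ i, (((k i : ℝ) + 1) * δ - k i * δ) = δ := fun i => by ring
  simp only [this, Finset.prod_const, Finset.card_univ, Fintype.card_fin]
  rw [ENNReal.ofReal_pow hδ.le]

theorem norm_sub_le_of_cell_eq {N : ℕ} {δ : ℝ} (hδ : 0 < δ) {x y : EuclideanSpace ℝ (Fin N)}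
    (h : cell δ y = cell δ x) : ‖y - x‖ ≤ N * δ := by
  have hi : ∀ i, ‖(y - x) i‖ ^ 2 ≤ δ ^ 2 := by
    intro i
    have h1 := Int.abs_sub_lt_one_of_floor_eq_floor (congrFun h i)
    rw [← sub_div, abs_div, abs_of_pos hδ, div_lt_one hδ] at h1
    have h2 : ‖(y - x) i‖ ≤ δ := h1.le
    gcongr
  rw [EuclideanSpace.norm_eq]
  refine Real.sqrt_le_iff.2 ⟨by positivity, (Finset.sum_le_sum fun i _ => hi i).trans ?_⟩
  rw [Finset.sum_const, Finset.card_univ, Fintype.card_fin, nsmul_eq_mul, mul_pow]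
  gcongr
  -- The diameter bound √N δ is relaxed to Nδ.
  exact_mod_cast Nat.le_self_pow two_ne_zero N

/-- The average of `f` over the cube containing `x`. -/
def cubeAverage {N : ℕ} (δ : ℝ) (f : EuclideanSpace ℝ (Fin N) → ℝ)
    (x : EuclideanSpace ℝ (Fin N)) : ℝ :=
  (δ ^ N)⁻¹ * ∫ y in cube δ (cell δ x), f y

/-- Jensen for the uniform probability on the cube. The cube is then enlarged to a ball around x, so
that the domain of h no longer depends on x and the integrals can be exchanged afterwards. -/
theorem enorm_sub_cubeAverage_rpow_le {N : ℕ} {δ : ℝ} (hδ : 0 < δ)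
    {f : EuclideanSpace ℝ (Fin N) → ℝ} (hf : Continuous f) (hfc : HasCompactSupport f) {q : ℝ}
    (hq : 1 ≤ q) (x : EuclideanSpace ℝ (Fin N)) :
    ‖f x - cubeAverage δ f x‖ₑ ^ q ≤ (ENNReal.ofReal (δ ^ N))⁻¹ *
      ∫⁻ h in Metric.closedBall 0 (N * δ), ‖f (x + h) - f x‖ₑ ^ q := by
  set Q := cube δ (cell δ x)
  have hQ : MeasurableSet Q := measurableSet_cube _ _
  have hvol : volume Q = ENNReal.ofReal (δ ^ N) := volume_cube hδ _
  set ν : Measure (EuclideanSpace ℝ (Fin N)) := (ENNReal.ofReal (δ ^ N))⁻¹ • volume.restrict Q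
  have hpos : ENNReal.ofReal (δ ^ N) ≠ 0 := by
    rw [Ne, ENNReal.ofReal_eq_zero, not_le]; positivity
  have : IsProbabilityMeasure ν := ⟨by
    rw [Measure.smul_apply, Measure.restrict_apply_univ, hvol, smul_eq_mul,
      ENNReal.inv_mul_cancel hpos ENNReal.ofReal_ne_top]⟩
  have hi : Integrable f ν :=
    (hf.integrable_of_hasCompactSupport hfc).restrict.smul_measure (ENNReal.inv_ne_top.2 hpos)
  have e : f x - cubeAverage δ f x = ∫ y, (f x - f y) ∂ν := by
    rw [integral_sub (integrable_const _) hi, integral_const, probReal_univ, one_smul,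
      integral_smul_measure, cubeAverage, ENNReal.toReal_inv, ENNReal.toReal_ofReal (by positivity),
      smul_eq_mul]
  have hm : Measurable fun y => ‖f x - f y‖ₑ := by fun_prop
  have hm2 : Measurable fun y => ‖f y - f x‖ₑ ^ q := by
    have : Measurable fun y => ‖f y - f x‖ₑ := by fun_prop
    exact this.pow_const q
  calc _ ≤ (∫⁻ y, ‖f x - f y‖ₑ ∂ν) ^ q := by
        rw [e]; gcongr; exact enorm_integral_le_lintegral_enorm _
    _ ≤ ∫⁻ y, ‖f x - f y‖ₑ ^ q ∂ν :=
        lintegral_rpow_le_of_isProbabilityMeasure ν hm.aemeasurable hq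
    _ = (ENNReal.ofReal (δ ^ N))⁻¹ * ∫⁻ y in Q, ‖f y - f x‖ₑ ^ q := by
        rw [lintegral_smul_measure, smul_eq_mul]
        simp only [enorm_sub_rev (f x)]
    _ ≤ _ := by
        gcongr (ENNReal.ofReal (δ ^ N))⁻¹ * ?_
        rw [← lintegral_indicator hQ, ← lintegral_indicator Metric.isClosed_closedBall.measurableSet,
          ← lintegral_add_left_eq_self _ x]
        refine lintegral_mono fun h => ?_
        by_cases hh : x + h ∈ Q
        · have h1 : cell δ (x + h) = cell δ x := hh
          have h2 := norm_sub_le_of_cell_eq hδ h1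
          rw [add_sub_cancel_left] at h2
          rw [indicator_of_mem hh, indicator_of_mem (mem_closedBall_zero_iff.2 h2)]
        · rw [indicator_of_notMem hh]; exact zero_le

/-- The constant in the approximation by averages over cubes. -/
def cubeConst (N : ℕ) : ℝ≥0∞ :=
  ENNReal.ofReal ((N : ℝ) ^ N) * volume (Metric.ball (0 : EuclideanSpace ℝ (Fin N)) 1)

theorem lintegral_sub_cubeAverage_rpow_le {N : ℕ} {δ : ℝ} (hδ : 0 < δ)
    {f : EuclideanSpace ℝ (Fin N) → ℝ} (hf : ContDiff ℝ 1 f) (hfc : HasCompactSupport f) {q : ℝ}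
    (hq : 1 ≤ q) :
    ∫⁻ x, ‖f x - cubeAverage δ f x‖ₑ ^ q ≤
      cubeConst N * ENNReal.ofReal (N * δ) ^ q * ∫⁻ x, ‖fderiv ℝ f x‖ₑ ^ q := by
  have hpos : ENNReal.ofReal (δ ^ N) ≠ 0 := by
    rw [Ne, ENNReal.ofReal_eq_zero, not_le]; positivity
  set B := Metric.closedBall (0 : EuclideanSpace ℝ (Fin N)) (N * δ)
  set D := ∫⁻ x, ‖fderiv ℝ f x‖ₑ ^ q
  have hm : Measurable (Function.uncurry fun (x h : EuclideanSpace ℝ (Fin N)) =>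
      ‖f (x + h) - f x‖ₑ ^ q) := by
    have hfc := hf.continuous
    have : Continuous fun z : EuclideanSpace ℝ (Fin N) × EuclideanSpace ℝ (Fin N) =>
      ‖f (z.1 + z.2) - f z.1‖ₑ := by fun_prop
    exact this.measurable.pow_const q
  calc _ ≤ ∫⁻ x, (ENNReal.ofReal (δ ^ N))⁻¹ * ∫⁻ h in B, ‖f (x + h) - f x‖ₑ ^ q :=
        lintegral_mono fun x => enorm_sub_cubeAverage_rpow_le hδ hf.continuous hfc hq x
    _ = (ENNReal.ofReal (δ ^ N))⁻¹ * ∫⁻ h in B, ∫⁻ x, ‖f (x + h) - f x‖ₑ ^ q := by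
        rw [lintegral_const_mul' _ _ (ENNReal.inv_ne_top.2 hpos),
          lintegral_lintegral_swap hm.aemeasurable]
    _ ≤ (ENNReal.ofReal (δ ^ N))⁻¹ * ∫⁻ _ in B, ENNReal.ofReal (N * δ) ^ q * D := by
        gcongr 1
        refine setLIntegral_mono measurable_const fun h hh => ?_
        refine (lintegral_enorm_translate_sub_rpow_le volume hf hq h).trans ?_
        gcongr
        rw [← ofReal_norm]
        exact ENNReal.ofReal_le_ofReal (mem_closedBall_zero_iff.1 hh)
    _ = _ := by
        -- The ball has volume (Nδ)^N |B₁|. Its δ^N cancels the normalisation, which leaves a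
        -- constant independent of δ.
        rw [setLIntegral_const, Measure.addHaar_closedBall _ _ (by positivity),
          finrank_euclideanSpace_fin, mul_pow,
          ENNReal.ofReal_mul (by positivity : 0 ≤ (N : ℝ) ^ N), cubeConst]
        generalize volume (Metric.ball (0 : EuclideanSpace ℝ (Fin N)) 1) = b
        calc _ = ((ENNReal.ofReal (δ ^ N))⁻¹ * ENNReal.ofReal (δ ^ N)) *
              (ENNReal.ofReal ((N : ℝ) ^ N) * b * ENNReal.ofReal (N * δ) ^ q * D) := by ring
          _ = _ := by rw [ENNReal.inv_mul_cancel hpos ENNReal.ofReal_ne_top, one_mul]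

theorem norm_indicator_one_le {X : Type*} (s : Set X) (x : X) :
    ‖s.indicator (fun _ => (1 : ℝ)) x‖ ≤ 1 :=
  (norm_indicator_le_norm_self _ x).trans (by simp)

theorem isCompactOperator_smulRight {V W : Type*} [NormedAddCommGroup V] [NormedSpace ℝ V]
    [NormedAddCommGroup W] [NormedSpace ℝ W] (φ : V →L[ℝ] ℝ) (w : W) :
    IsCompactOperator (φ.smulRight w) :=
  (isCompactOperator_of_locallyCompactSpace_rng (ContinuousLinearMap.toSpanSingleton ℝ w)).comp_clm φ

/-- Averaging over finitely many cubes, as an operator on `L^r(Ω)`. -/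
def cubeAverageCLM {N : ℕ} (r : ℝ≥0∞) [Fact (1 ≤ r)] (Ω : Set (EuclideanSpace ℝ (Fin N)))
    [IsFiniteMeasure (volume.restrict Ω)] (δ : ℝ) (s : Finset (Fin N → ℤ)) :
    Lp ℝ r (volume.restrict Ω) →L[ℝ] Lp ℝ r (volume.restrict Ω) :=
  ∑ k ∈ s, (integralMul ((cube δ k).indicator fun _ => 1) 1
    (aestronglyMeasurable_const.indicator (measurableSet_cube δ k))
    (norm_indicator_one_le _)).smulRight
      (indicatorConstLp r (measurableSet_cube δ k) (measure_ne_top _ _) (δ ^ N)⁻¹)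

theorem isCompactOperator_cubeAverageCLM {N : ℕ} (r : ℝ≥0∞) [Fact (1 ≤ r)]
    (Ω : Set (EuclideanSpace ℝ (Fin N))) [IsFiniteMeasure (volume.restrict Ω)] (δ : ℝ)
    (s : Finset (Fin N → ℤ)) : IsCompactOperator (cubeAverageCLM r Ω δ s) := by
  unfold cubeAverageCLM
  induction s using Finset.cons_induction with
  | empty => simpa using isCompactOperator_zero
  | cons k s hk ih =>
    rw [Finset.sum_cons]
    refine IsCompactOperator.add ?_ ih
    exact isCompactOperator_smulRight _ _

/-- Extension of f by zero makes averages over cubes crossing the boundary depend only on its values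
in Ω. In the sum only the cube containing x survives. -/
theorem cubeAverageCLM_coeFn {N : ℕ} (r : ℝ≥0∞) [Fact (1 ≤ r)]
    {Ω : Set (EuclideanSpace ℝ (Fin N))} [IsFiniteMeasure (volume.restrict Ω)]
    (hΩ : MeasurableSet Ω) (δ : ℝ) {s : Finset (Fin N → ℤ)} (hs : ∀ x ∈ Ω, cell δ x ∈ s)
    {u : Lp ℝ r (volume.restrict Ω)} {f : EuclideanSpace ℝ (Fin N) → ℝ}
    (huf : u =ᵐ[volume.restrict Ω] f) (hf : ∀ x ∉ Ω, f x = 0) :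
    cubeAverageCLM r Ω δ s u =ᵐ[volume.restrict Ω] cubeAverage δ f := by
  have hint : ∀ k, ∫ x in Ω, u x * (cube δ k).indicator (fun _ => 1) x = ∫ x in cube δ k, f x := by
    intro k
    rw [← integral_indicator (measurableSet_cube δ k),
      ← setIntegral_eq_integral_of_forall_compl_eq_zero (s := Ω)
        (f := (cube δ k).indicator f)]
    · refine integral_congr_ae (huf.mono fun x hx => ?_)
      by_cases h : x ∈ cube δ k <;> simp [h, hx]
    · intro x hx
      by_cases h : x ∈ cube δ k <;> simp [h, hf x hx]
  have e : cubeAverageCLM r Ω δ s u = ∑ k ∈ s, (∫ x in cube δ k, f x) •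
      indicatorConstLp r (measurableSet_cube δ k) (measure_ne_top _ _) (δ ^ N)⁻¹ := by
    simp only [cubeAverageCLM, sum_apply, ContinuousLinearMap.smulRight_apply,
      integralMul_apply, hint]
  have h1 : ∀ k : Fin N → ℤ, ∀ᵐ x ∂(volume.restrict Ω),
      ((∫ x in cube δ k, f x) • indicatorConstLp r (measurableSet_cube δ k)
        (measure_ne_top (volume.restrict Ω) _) (δ ^ N)⁻¹ : Lp ℝ r (volume.restrict Ω)) x
        = (∫ x in cube δ k, f x) * (cube δ k).indicator (fun _ => (δ ^ N)⁻¹) x := fun k => by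
    filter_upwards [Lp.coeFn_smul (∫ x in cube δ k, f x) (indicatorConstLp r
      (measurableSet_cube δ k) (measure_ne_top (volume.restrict Ω) _) (δ ^ N)⁻¹ : Lp ℝ r _),
      indicatorConstLp_coeFn (p := r) (μ := volume.restrict Ω) (hs := measurableSet_cube δ k)
        (hμs := measure_ne_top _ _) (c := (δ ^ N)⁻¹)] with x h1 h2
    rw [h1, Pi.smul_apply, h2, smul_eq_mul]
  rw [e]
  filter_upwards [Lp.coeFn_finsetSum s fun k => (∫ x in cube δ k, f x) •
      (indicatorConstLp r (measurableSet_cube δ k) (measure_ne_top (volume.restrict Ω) _)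
        (δ ^ N)⁻¹ : Lp ℝ r (volume.restrict Ω)),
    ae_all_iff.2 h1, ae_restrict_mem hΩ] with x hx hx1 hxΩ
  rw [hx, Finset.sum_apply, Finset.sum_congr rfl fun k _ => hx1 k,
    Finset.sum_eq_single_of_mem (cell δ x) (hs x hxΩ)]
  · rw [indicator_of_mem (by rfl : x ∈ cube δ (cell δ x)), mul_comm, cubeAverage]
  · intro k _ hk
    have hxk : x ∉ cube δ k := fun h => hk (Eq.symm h)
    rw [indicator_of_notMem hxk, mul_zero]

theorem exists_finset_cell_mem {N : ℕ} {Ω : Set (EuclideanSpace ℝ (Fin N))}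
    (hb : Bornology.IsBounded Ω) {δ : ℝ} (hδ : 0 < δ) :
    ∃ s : Finset (Fin N → ℤ), ∀ x ∈ Ω, cell δ x ∈ s := by
  obtain ⟨R, hR⟩ := hb.subset_closedBall 0
  refine ⟨Fintype.piFinset fun _ => Finset.Icc ⌊-R / δ⌋ ⌊R / δ⌋, fun x hx => ?_⟩
  rw [Fintype.mem_piFinset]
  intro i
  have h1 : |x i| ≤ R := (PiLp.norm_apply_le x i).trans (mem_closedBall_zero_iff.1 (hR hx))
  rw [abs_le] at h1
  rw [Finset.mem_Icc]
  exact ⟨Int.floor_le_floor (by gcongr; exact h1.1), Int.floor_le_floor (by gcongr; exact h1.2)⟩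

/-- The constant is independent of δ, so on bounded sets of W^{1,r}_0 the inclusion into L^r is a
uniform limit of finite-rank operators. -/
theorem exists_norm_sub_cubeAverageCLM_le {N : ℕ} (r : ℝ) [hr : Fact (1 < r)]
    {Ω : Set (EuclideanSpace ℝ (Fin N))} [IsFiniteMeasure (volume.restrict Ω)] (hΩ : IsOpen Ω) :
    ∃ K : ℝ, 0 ≤ K ∧ ∀ δ : ℝ, 0 < δ → ∀ s : Finset (Fin N → ℤ), (∀ x ∈ Ω, cell δ x ∈ s) →
      ∀ u : sobolevZero r Ω,
        ‖u.1.1.1 - cubeAverageCLM (ENNReal.ofReal r) Ω δ s u.1.1.1‖ ≤ K * δ * ‖u.1.1.2‖ := by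
  have h0 : 0 < r := zero_lt_one.trans hr.out
  have hc : cubeConst N ^ r⁻¹ ≠ ⊤ := ENNReal.rpow_ne_top_of_nonneg (by positivity)
    (ENNReal.mul_ne_top ENNReal.ofReal_ne_top measure_ball_lt_top.ne)
  refine ⟨(cubeConst N ^ r⁻¹).toReal * N, by positivity, fun δ hδ s hs =>
    sobolevZero_induction (P := fun w => ‖w.1.1 - cubeAverageCLM (ENNReal.ofReal r) Ω δ s w.1.1‖
      ≤ (cubeConst N ^ r⁻¹).toReal * N * δ * ‖w.1.2‖) ?_ ?_⟩
  · have c1 : Continuous fun w : sobolev r Ω => w.1.1 :=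
      continuous_fst.comp continuous_subtype_val
    exact isClosed_le (c1.sub ((cubeAverageCLM (ENNReal.ofReal r) Ω δ s).continuous.comp c1)).norm
      ((continuous_snd.comp continuous_subtype_val).norm.const_mul _)
  intro w f hf hwf
  have h1 : ‖w.1.1 - cubeAverageCLM (ENNReal.ofReal r) Ω δ s w.1.1‖ₑ ^ r
      ≤ (cubeConst N ^ r⁻¹ * ENNReal.ofReal (N * δ) * ‖w.1.2‖ₑ) ^ r := by
    rw [enorm_rpow_eq_lintegral, ENNReal.mul_rpow_of_nonneg _ _ h0.le,
      ENNReal.mul_rpow_of_nonneg _ _ h0.le, ENNReal.rpow_inv_rpow h0.ne',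
      ← lintegral_enorm_fderiv_rpow_eq hΩ hf w hwf]
    refine le_trans ?_ (lintegral_sub_cubeAverage_rpow_le hδ (hf.contDiff.of_le (by simp))
      hf.hasCompactSupport hr.out.le)
    refine le_trans (lintegral_mono_ae ?_) (setLIntegral_le_lintegral Ω _)
    filter_upwards [hwf, Lp.coeFn_sub w.1.1 (cubeAverageCLM (ENNReal.ofReal r) Ω δ s w.1.1),
      cubeAverageCLM_coeFn (ENNReal.ofReal r) hΩ.measurableSet δ hs hwf
        fun x hx => hf.eq_zero_of_notMem hx] with x h1 h2 h3
    rw [h2, Pi.sub_apply, h1, h3]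
  rw [ENNReal.rpow_le_rpow_iff h0] at h1
  have h2 := ENNReal.toReal_mono (ENNReal.mul_ne_top (ENNReal.mul_ne_top hc
    ENNReal.ofReal_ne_top) enorm_ne_top) h1
  rw [ENNReal.toReal_mul, ENNReal.toReal_mul, ENNReal.toReal_ofReal (by positivity),
    toReal_enorm, toReal_enorm, ← mul_assoc] at h2
  exact h2

theorem exists_subseq_tendsto_fst {U V : Type*} [NormedAddCommGroup U] [NormedSpace ℝ U]
    [CompleteSpace U] [NormedAddCommGroup V] {S : ℕ → U →L[ℝ] U}
    (hS : ∀ n, IsCompactOperator (S n)) {K : ℝ} (hK : 0 ≤ K) {z : ℕ → U × V} {M : ℝ}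
    (h : ∀ n k, ‖(z k).1 - S n (z k).1‖ ≤ K * (1 / ((n : ℝ) + 1)) * ‖(z k).2‖)
    (hM1 : ∀ k, ‖(z k).1‖ ≤ M) (hM2 : ∀ k, ‖(z k).2‖ ≤ M) :
    ∃ u : U, ∃ φ : ℕ → ℕ, StrictMono φ ∧
      Filter.Tendsto (fun k => (z (φ k)).1) Filter.atTop (nhds u) := by
  -- One `S n` is uniformly ε/2-close to the identity along the sequence, and an ε/2-net of a
  -- compact set containing its values is an ε-net of the sequence.
  have htb : TotallyBounded (range fun k => (z k).1) := by
    rw [Metric.totallyBounded_iff]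
    intro ε hε
    have hM0 : 0 ≤ M := (norm_nonneg _).trans (hM2 0)
    have hlim : Filter.Tendsto (fun n : ℕ => K * (1 / ((n : ℝ) + 1)) * M) Filter.atTop
        (nhds 0) := by
      simpa using (tendsto_one_div_add_atTop_nhds_zero_nat.const_mul K).mul_const M
    obtain ⟨n, hn⟩ := (hlim.eventually (gt_mem_nhds (half_pos hε))).exists
    obtain ⟨L, hL, hLs⟩ := (hS n).image_closedBall_subset_compact (f := (S n : U →ₗ[ℝ] U)) M
    obtain ⟨t, ht, hLt⟩ := Metric.totallyBounded_iff.1 hL.totallyBounded _ (half_pos hε)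
    refine ⟨t, ht, ?_⟩
    rintro _ ⟨k, rfl⟩
    have hk : S n (z k).1 ∈ L := hLs ⟨(z k).1, mem_closedBall_zero_iff.2 (hM1 k), rfl⟩
    obtain ⟨y, hy, hyk⟩ := mem_iUnion₂.1 (hLt hk)
    refine mem_iUnion₂.2 ⟨y, hy, ?_⟩
    rw [Metric.mem_ball] at hyk ⊢
    have h1 : dist (z k).1 (S n (z k).1) < ε / 2 := by
      rw [dist_eq_norm]
      refine (h n k).trans_lt (lt_of_le_of_lt ?_ hn)
      gcongr
      exact hM2 k
    linarith [dist_triangle (z k).1 (S n (z k).1) y]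
  have hc : IsCompact (closure (range fun k => (z k).1)) :=
    htb.closure.isCompact_of_isClosed isClosed_closure
  obtain ⟨u, _, φ, hφ, hu⟩ := hc.isSeqCompact fun k => subset_closure (mem_range_self k)
  exact ⟨u, φ, hφ, hu⟩

/-- **Rellich-Kondrachov**: bounded sequences of `W^{1,r}_0(Ω)` have subsequences converging in
`L^r(Ω)`. -/
theorem exists_subseq_tendsto_of_mem_sobolevZeroProd {N : ℕ} (r : ℝ) [Fact (1 < r)]
    {Ω : Set (EuclideanSpace ℝ (Fin N))} [IsFiniteMeasure (volume.restrict Ω)] (hΩ : IsOpen Ω)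
    (hb : Bornology.IsBounded Ω) {z : ℕ → Lp ℝ (ENNReal.ofReal r) (volume.restrict Ω) ×
      Lp (EuclideanSpace ℝ (Fin N)) (ENNReal.ofReal r) (volume.restrict Ω)}
    (hz : ∀ k, z k ∈ sobolevZeroProd r Ω) {M : ℝ} (hM1 : ∀ k, ‖(z k).1‖ ≤ M)
    (hM2 : ∀ k, ‖(z k).2‖ ≤ M) :
    ∃ u : Lp ℝ (ENNReal.ofReal r) (volume.restrict Ω), ∃ φ : ℕ → ℕ, StrictMono φ ∧
      Filter.Tendsto (fun k => (z (φ k)).1) Filter.atTop (nhds u) := by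
  obtain ⟨K, hK0, hK⟩ := exists_norm_sub_cubeAverageCLM_le r hΩ
  choose s hs using fun n : ℕ =>
    exists_finset_cell_mem hb (Nat.one_div_pos_of_nat (α := ℝ) (n := n))
  refine exists_subseq_tendsto_fst
    (fun n => isCompactOperator_cubeAverageCLM (ENNReal.ofReal r) Ω (1 / ((n : ℝ) + 1)) (s n))
    hK0 (fun n k => ?_) hM1 hM2
  obtain ⟨u, hu⟩ := mem_sobolevZeroProd.1 (hz k)
  rw [← hu]
  exact hK _ Nat.one_div_pos_of_nat (s n) (hs n) u

/-! ### Substitute for weak limits -/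

/-- A sequence in `U × L^r` whose first components converge and whose second components are
bounded has a point in the intersection of all closed convex sets eventually containing it. -/
theorem exists_mem_of_closed_convex {U : Type*} [NormedAddCommGroup U] [NormedSpace ℝ U]
    {X : Type*} [MeasurableSpace X] {μ : Measure X} {E : Type*} [NormedAddCommGroup E]
    [InnerProductSpace ℝ E] [FiniteDimensional ℝ E] {r : ℝ} [hr : Fact (1 < r)]
    {z : ℕ → U × Lp E (ENNReal.ofReal r) μ} {M : ℝ} (hM : ∀ k, ‖(z k).2‖ ≤ M) {u : U}
    (hu : Filter.Tendsto (fun k => (z k).1) Filter.atTop (nhds u)) :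
    ∃ g : Lp E (ENNReal.ofReal r) μ, ∀ s : Set (U × Lp E (ENNReal.ofReal r) μ), Convex ℝ s →
      IsClosed s → (∀ᶠ k in Filter.atTop, z k ∈ s) → (u, g) ∈ s := by
  have h0 : 0 < r := zero_lt_one.trans hr.out
  -- Any convex set eventually containing the sequence contains some hull of a tail, so elements
  -- chosen from these hulls eventually lie in it. Balls around `u` are such sets, which forces the
  -- first components to converge to `u`.
  let K : ℕ → Set (U × Lp E (ENNReal.ofReal r) μ) := fun n => convexHull ℝ (z '' Ici n)
  have hKs : ∀ s : Set (U × Lp E (ENNReal.ofReal r) μ), Convex ℝ s →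
      (∀ᶠ k in Filter.atTop, z k ∈ s) → ∀ᶠ n in Filter.atTop, K n ⊆ s := by
    intro s hs h
    obtain ⟨n, hn⟩ := Filter.eventually_atTop.1 h
    filter_upwards [Filter.eventually_ge_atTop n] with m hm
    refine convexHull_min ?_ hs
    rintro _ ⟨k, hk, rfl⟩
    exact hn k (le_trans hm hk)
  have hbd : ∀ v ∈ K 0, ‖LinearMap.snd ℝ U (Lp E (ENNReal.ofReal r) μ) v‖ ^ r ≤ M ^ r := by
    intro v hv
    have hc : Convex ℝ {v : U × Lp E (ENNReal.ofReal r) μ | ‖v.2‖ ≤ M} := by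
      have := (convex_closedBall (0 : Lp E (ENNReal.ofReal r) μ) M).linear_preimage
        (LinearMap.snd ℝ U (Lp E (ENNReal.ofReal r) μ))
      refine Eq.subst (motive := Convex ℝ) ?_ this
      ext v
      simp
    have h1 : v ∈ {v : U × Lp E (ENNReal.ofReal r) μ | ‖v.2‖ ≤ M} := by
      refine convexHull_min ?_ hc hv
      rintro _ ⟨k, _, rfl⟩
      exact hM k
    exact Real.rpow_le_rpow (norm_nonneg _) h1 h0.le
  obtain ⟨w, hwK, hwc⟩ := exists_cauchySeq_of_convex
    (LinearMap.snd ℝ U (Lp E (ENNReal.ofReal r) μ)) (K := K)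
    (fun m n hmn => convexHull_mono (image_mono (Ici_subset_Ici.2 hmn)))
    (fun n => convex_convexHull ℝ _) (fun n => (convexHull_nonempty_iff.2 ⟨_, n, mem_Ici.2 le_rfl, rfl⟩)) hbd
  obtain ⟨g, hg⟩ := cauchySeq_tendsto_of_complete hwc
  have hw1 : Filter.Tendsto (fun n => (w n).1) Filter.atTop (nhds u) := by
    rw [Metric.tendsto_nhds]
    intro ε hε
    have hc : Convex ℝ {v : U × Lp E (ENNReal.ofReal r) μ | v.1 ∈ Metric.ball u ε} :=
      (convex_ball u ε).linear_preimage (LinearMap.fst ℝ U (Lp E (ENNReal.ofReal r) μ))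
    filter_upwards [hKs _ hc (hu.eventually (Metric.ball_mem_nhds u hε))] with n hn
    exact hn (hwK n)
  have hw : Filter.Tendsto w Filter.atTop (nhds (u, g)) := hw1.prodMk_nhds hg
  refine ⟨g, fun s hs hsc h => hsc.mem_of_tendsto hw ?_⟩
  filter_upwards [hKs s hs h] with n hn
  exact hn (hwK n)

/-! ### Rayleigh quotient and existence of an eigenvalue -/

theorem exists_mem_sobolevZeroProd_ne_zero {N : ℕ} (r : ℝ) [hr : Fact (1 < r)]
    {Ω : Set (EuclideanSpace ℝ (Fin N))} (hΩ : IsOpen Ω) (hne : Ω.Nonempty) :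
    ∃ z ∈ sobolevZeroProd r Ω, z.1 ≠ 0 := by
  obtain ⟨x₀, hx₀⟩ := hne
  obtain ⟨f, hfs, hfc, hfd, -, hf1⟩ := exists_contDiff_tsupport_subset (n := (⊤ : ℕ∞))
    (hΩ.mem_nhds hx₀)
  have hf : IsTestFunction Ω f := ⟨hfd, hfc, hfs⟩
  let G : EuclideanSpace ℝ (Fin N) → EuclideanSpace ℝ (Fin N) := gradient f
  have hGc : Continuous G :=
    (InnerProductSpace.toDual ℝ _).symm.continuous.comp (hfd.continuous_fderiv (by simp))
  have hGs : HasCompactSupport G := (hfc.fderiv (𝕜 := ℝ)).comp_left (map_zero _)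
  have hGi : ∀ x v, inner ℝ (G x) v = fderiv ℝ f x v := fun x v => by
    simp [G, gradient]
  have mf : MemLp f (ENNReal.ofReal r) (volume.restrict Ω) :=
    (hfd.continuous.memLp_of_hasCompactSupport hfc).restrict Ω
  have mG : MemLp G (ENNReal.ofReal r) (volume.restrict Ω) :=
    (hGc.memLp_of_hasCompactSupport hGs).restrict Ω
  have hw : IsWeakGradient Ω (mf.toLp f) (mG.toLp G) := by
    intro g hg v
    have e1 : ∫ x in Ω, mf.toLp f x * fderiv ℝ g x v = ∫ x in Ω, f x * fderiv ℝ g x v :=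
      integral_congr_ae (mf.coeFn_toLp.mono fun x hx => congrArg (· * fderiv ℝ g x v) hx)
    have e2 : ∫ x in Ω, inner ℝ (mG.toLp G x) v * g x = ∫ x in Ω, fderiv ℝ f x v * g x :=
      integral_congr_ae (mG.coeFn_toLp.mono fun x hx => by
        simp only [hx, hGi])
    rw [e1, e2, hf.setIntegral_mul_fderiv hg]
  let w : sobolev r Ω := ⟨(mf.toLp f, mG.toLp G), hw⟩
  have hwt : w ∈ testSubspace r Ω := ⟨f, hf, mf.coeFn_toLp⟩
  have hwz : w ∈ sobolevZero r Ω := (testSubspace r Ω).le_topologicalClosure hwt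
  refine ⟨(mf.toLp f, mG.toLp G), ⟨⟨w, hwz⟩, rfl⟩, fun h => ?_⟩
  have h1 : f =ᵐ[volume.restrict Ω] 0 :=
    mf.coeFn_toLp.symm.trans ((show mf.toLp f = 0 from h) ▸ Lp.coeFn_zero _ _ _)
  have h2 : f =ᵐ[volume] fun _ => 0 := by
    filter_upwards [(ae_restrict_iff' hΩ.measurableSet).1 h1] with x hx
    by_cases hxΩ : x ∈ Ω
    · exact hx hxΩ
    · exact hf.eq_zero_of_notMem hxΩ
  have h3 := (hfd.continuous.ae_eq_iff_eq volume continuous_const).1 h2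
  rw [h3] at hf1
  exact zero_ne_one hf1

/-- Weak sequential compactness of bounded sets of `W^{1,r}_0(Ω)`, normalised in `L^r(Ω)`. -/
theorem exists_mem_sobolevZeroProd_of_bounded {N : ℕ} (r : ℝ) [Fact (1 < r)]
    {Ω : Set (EuclideanSpace ℝ (Fin N))} [IsFiniteMeasure (volume.restrict Ω)] (hΩ : IsOpen Ω)
    (hb : Bornology.IsBounded Ω) {z : ℕ → Lp ℝ (ENNReal.ofReal r) (volume.restrict Ω) ×
      Lp (EuclideanSpace ℝ (Fin N)) (ENNReal.ofReal r) (volume.restrict Ω)}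
    (hz : ∀ k, z k ∈ sobolevZeroProd r Ω) {M : ℝ} (h1 : ∀ k, ‖(z k).1‖ = 1)
    (h2 : ∀ k, ‖(z k).2‖ ≤ M) :
    ∃ y ∈ sobolevZeroProd r Ω, ‖y.1‖ = 1 ∧
      ∀ s : Set (Lp ℝ (ENNReal.ofReal r) (volume.restrict Ω) ×
        Lp (EuclideanSpace ℝ (Fin N)) (ENNReal.ofReal r) (volume.restrict Ω)), Convex ℝ s →
        IsClosed s → (∀ᶠ k in Filter.atTop, z k ∈ s) → y ∈ s := by
  obtain ⟨u, φ, hφ, hu⟩ := exists_subseq_tendsto_of_mem_sobolevZeroProd r hΩ hb hz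
    (M := max 1 M) (fun k => (h1 k).trans_le (le_max_left _ _))
    (fun k => (h2 k).trans (le_max_right _ _))
  obtain ⟨g, hg⟩ := exists_mem_of_closed_convex (z := fun k => z (φ k)) (fun k => h2 (φ k)) hu
  refine ⟨(u, g), ?_, ?_, fun s hs hsc h => hg s hs hsc (hφ.tendsto_atTop.eventually h)⟩
  · exact hg (sobolevZeroProd r Ω) (Submodule.convex _) (isClosed_sobolevZeroProd r Ω)
      (Filter.Eventually.of_forall fun k => hz (φ k))
  · have := hu.norm
    simp only [h1] at this
    exact (tendsto_nhds_unique this tendsto_const_nhds)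

theorem convexOn_norm_snd_rpow {U V : Type*} [NormedAddCommGroup U] [NormedSpace ℝ U]
    [NormedAddCommGroup V] [NormedSpace ℝ V] {q : ℝ} (hq : 1 ≤ q) :
    ConvexOn ℝ univ fun w : U × V => ‖w.2‖ ^ q :=
  (convexOn_norm_rpow (E := V) hq).comp_linearMap (LinearMap.snd ℝ U V)

/-- Existence of a minimiser of the Rayleigh quotient. -/
theorem exists_rayleigh_minimizer {N : ℕ} (r : ℝ) [Fact (1 < r)]
    {Ω : Set (EuclideanSpace ℝ (Fin N))} [IsFiniteMeasure (volume.restrict Ω)] (hΩ : IsOpen Ω)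
    (hb : Bornology.IsBounded Ω) (hne : Ω.Nonempty) :
    ∃ y ∈ sobolevZeroProd r Ω, ‖y.1‖ = 1 ∧ ∀ z ∈ sobolevZeroProd r Ω, ‖y.2‖ * ‖z.1‖ ≤ ‖z.2‖ := by
  let S : Set ℝ := (fun z => ‖z.2‖) '' {z | z ∈ sobolevZeroProd r Ω ∧ ‖z.1‖ = 1}
  have hbdd : BddBelow S := ⟨0, by rintro _ ⟨z, _, rfl⟩; exact norm_nonneg _⟩
  have hscale : ∀ z ∈ sobolevZeroProd r Ω, z.1 ≠ 0 →
      ‖z.1‖⁻¹ • z ∈ {z | z ∈ sobolevZeroProd r Ω ∧ ‖z.1‖ = 1} := fun z hz h0 =>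
    ⟨Submodule.smul_mem _ _ hz, by
      rw [Prod.smul_fst, norm_smul, norm_inv, norm_norm, inv_mul_cancel₀ (norm_ne_zero_iff.2 h0)]⟩
  have hS : S.Nonempty := by
    obtain ⟨z, hz, h0⟩ := exists_mem_sobolevZeroProd_ne_zero r hΩ hne
    exact ⟨_, _, hscale z hz h0, rfl⟩
  have hex : ∀ k : ℕ, ∃ z, (z ∈ sobolevZeroProd r Ω ∧ ‖z.1‖ = 1) ∧
      ‖z.2‖ < sInf S + 1 / ((k : ℝ) + 1) := by
    intro k
    obtain ⟨_, ⟨z, hz, rfl⟩, h⟩ := exists_lt_of_csInf_lt hS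
      (lt_add_of_pos_right (sInf S) (Nat.one_div_pos_of_nat (n := k)))
    exact ⟨z, hz, h⟩
  choose z hz hzS using hex
  obtain ⟨y, hy, hy1, hys⟩ := exists_mem_sobolevZeroProd_of_bounded r hΩ hb (M := sInf S + 1)
    (fun k => (hz k).1) (fun k => (hz k).2) (fun k => by
      have : 1 / ((k : ℝ) + 1) ≤ 1 := by
        rw [div_le_one (by positivity)]; linarith [Nat.cast_nonneg (α := ℝ) k]
      linarith [hzS k])
  -- Weak lower semicontinuity of the norm: each ball of radius `sInf S + ε` is closed, convex and
  -- eventually contains the gradients.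
  have hyS : ‖y.2‖ ≤ sInf S := by
    refine le_of_forall_pos_le_add fun ε hε => ?_
    refine hys {v | ‖v.2‖ ≤ sInf S + ε} ?_ (isClosed_le continuous_snd.norm continuous_const) ?_
    · have := (convexOn_norm_snd_rpow (U := Lp ℝ (ENNReal.ofReal r) (volume.restrict Ω))
        (V := Lp (EuclideanSpace ℝ (Fin N)) (ENNReal.ofReal r) (volume.restrict Ω))
        (le_refl (1 : ℝ))).convex_le (sInf S + ε)
      simpa using this
    · filter_upwards [tendsto_one_div_add_atTop_nhds_zero_nat.eventually (gt_mem_nhds hε)]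
        with k hk
      have := hzS k
      change ‖(z k).2‖ ≤ _
      linarith
  refine ⟨y, hy, hy1, fun v hv => ?_⟩
  by_cases h0 : v.1 = 0
  · rw [h0, norm_zero, mul_zero]; exact norm_nonneg _
  · have h1 : sInf S ≤ ‖(‖v.1‖⁻¹ • v).2‖ := csInf_le hbdd ⟨_, hscale v hv h0, rfl⟩
    rw [Prod.smul_snd, norm_smul, norm_inv, norm_norm, inv_mul_eq_div,
      le_div_iff₀ (norm_pos_iff.2 h0)] at h1
    exact le_trans (by gcongr) h1

/-- Euler's identity for an r-homogeneous function. -/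
theorem normRpowDeriv_self {X : Type*} [MeasurableSpace X] {μ : Measure X} {E : Type*}
    [NormedAddCommGroup E] [InnerProductSpace ℝ E] {r : ℝ} [hr : Fact (1 < r)]
    (f : Lp E (ENNReal.ofReal r) μ) : normRpowDeriv f f = r * ‖f‖ ^ r := by
  have h0 : 0 < r := zero_lt_one.trans hr.out
  rw [normRpowDeriv_apply, norm_rpow_eq_integral]
  congr 2
  ext x
  rw [real_inner_self_eq_norm_sq]
  rcases eq_or_ne (f x) 0 with h | h
  · rw [h, norm_zero, Real.zero_rpow h0.ne', zero_pow two_ne_zero, mul_zero]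
  · rw [← Real.rpow_natCast, ← Real.rpow_add (norm_pos_iff.2 h)]
    norm_num

theorem normRpowDeriv_real {X : Type*} [MeasurableSpace X] {μ : Measure X} {r : ℝ}
    [Fact (1 < r)] (f h : Lp ℝ (ENNReal.ofReal r) μ) :
    normRpowDeriv f h = r * ∫ x, |f x| ^ (r - 2) * f x * h x ∂μ := by
  rw [normRpowDeriv_apply]
  congr 2
  ext x
  rw [Real.norm_eq_abs, real_inner_eq_re_inner, RCLike.inner_apply]
  simp only [conj_trivial, RCLike.re_to_real]
  ring

theorem hasDerivAt_norm_rpow_line {X : Type*} [MeasurableSpace X] {μ : Measure X} {E : Type*}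
    [NormedAddCommGroup E] [InnerProductSpace ℝ E] [FiniteDimensional ℝ E] {r : ℝ}
    [Fact (1 < r)] (f h : Lp E (ENNReal.ofReal r) μ) :
    HasDerivAt (fun t : ℝ => ‖f + t • h‖ ^ r) (normRpowDeriv f h) 0 := by
  have hl : HasDerivAt (fun t : ℝ => f + t • h) h 0 := by
    simpa using ((hasDerivAt_id (0 : ℝ)).smul_const h).const_add f
  have hF : HasFDerivAt (fun g : Lp E (ENNReal.ofReal r) μ => ‖g‖ ^ r) (normRpowDeriv f)
      (f + (0 : ℝ) • h) := by
    rw [zero_smul, add_zero]; exact hasFDerivAt_norm_rpow_Lp f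
  exact hF.comp_hasDerivAt (0 : ℝ) hl

/-- `-Δ_r` has an eigenvalue on `W^{1,r}_0(Ω)`. -/
theorem exists_isEigenvalue {N : ℕ} (r : ℝ) [hr : Fact (1 < r)]
    {Ω : Set (EuclideanSpace ℝ (Fin N))} [IsFiniteMeasure (volume.restrict Ω)] (hΩ : IsOpen Ω)
    (hb : Bornology.IsBounded Ω) (hne : Ω.Nonempty) : ∃ mu, IsEigenvalue r Ω mu := by
  have h0 : 0 < r := zero_lt_one.trans hr.out
  obtain ⟨y, hy, hy1, hmin⟩ := exists_rayleigh_minimizer r hΩ hb hne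
  obtain ⟨u, rfl⟩ := mem_sobolevZeroProd.1 hy
  refine ⟨‖u.1.1.2‖ ^ r, u, fun hu => ?_, fun h => ?_⟩
  · have : u.1.1.1 = 0 := by rw [hu]; rfl
    rw [this, norm_zero] at hy1
    exact zero_ne_one hy1
  · have hd := (hasDerivAt_norm_rpow_line u.1.1.2 h.1.1.2).sub
      ((hasDerivAt_norm_rpow_line u.1.1.1 h.1.1.1).const_mul (‖u.1.1.2‖ ^ r))
    -- By minimality this function is nonnegative, and it vanishes at t = 0 because ‖u‖_r = 1. Its
    -- zero derivative there is the weak eigenvalue equation, multiplied by r.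
    have hloc : IsLocalMin (fun t : ℝ => ‖u.1.1.2 + t • h.1.1.2‖ ^ r
        - ‖u.1.1.2‖ ^ r * ‖u.1.1.1 + t • h.1.1.1‖ ^ r) 0 := by
      refine Filter.Eventually.of_forall fun t => ?_
      have hmem : u.1.1 + t • h.1.1 ∈ sobolevZeroProd r Ω :=
        Submodule.add_mem _ hy (Submodule.smul_mem _ t ⟨h, rfl⟩)
      have h1 := Real.rpow_le_rpow (by positivity) (hmin _ hmem) h0.le
      rw [Real.mul_rpow (norm_nonneg _) (norm_nonneg _)] at h1
      simp only [zero_smul, add_zero, hy1, Real.one_rpow, mul_one, sub_self]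
      exact sub_nonneg.2 h1
    have hz := hloc.hasDerivAt_eq_zero hd
    rw [normRpowDeriv_apply, normRpowDeriv_real] at hz
    have hz2 : r * ∫ x in Ω, ‖grad u x‖ ^ (r - 2) * inner ℝ (grad u x) (grad h x)
        = r * (‖u.1.1.2‖ ^ r * ∫ x in Ω, |fn u x| ^ (r - 2) * fn u x * fn h x) := by
      rw [mul_left_comm]
      exact sub_eq_zero.1 hz
    exact mul_left_cancel₀ h0.ne' hz2

/-- The weak equation tested with the eigenfunction itself. -/
theorem IsEigenvalue.exists_norm_grad_eq {N : ℕ} {r : ℝ} [hr : Fact (1 < r)]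
    {Ω : Set (EuclideanSpace ℝ (Fin N))} {mu : ℝ} (h : IsEigenvalue r Ω mu) :
    ∃ z ∈ sobolevZeroProd r Ω, z.1 ≠ 0 ∧ ‖z.2‖ ^ r = mu * ‖z.1‖ ^ r := by
  have h0 : 0 < r := zero_lt_one.trans hr.out
  obtain ⟨u, hu, h⟩ := h
  have hmem : u.1.1 ∈ sobolevZeroProd r Ω := mem_sobolevZeroProd.2 ⟨u, rfl⟩
  have h1 : r * ∫ x in Ω, ‖grad u x‖ ^ (r - 2) * inner ℝ (grad u x) (grad u x)
      = mu * (r * ∫ x in Ω, |fn u x| ^ (r - 2) * fn u x * fn u x) := by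
    rw [h u, mul_left_comm]
  have e1 : r * ‖u.1.1.2‖ ^ r = mu * (r * ‖u.1.1.1‖ ^ r) := by
    rw [← normRpowDeriv_self, ← normRpowDeriv_self, normRpowDeriv_apply, normRpowDeriv_real]
    exact h1
  rw [mul_left_comm] at e1
  have e2 := mul_left_cancel₀ h0.ne' e1
  refine ⟨u.1.1, hmem, fun hz => hu ?_, e2⟩
  rw [hz, norm_zero, Real.zero_rpow h0.ne', mul_zero, Real.rpow_eq_zero (norm_nonneg _) h0.ne',
    norm_eq_zero] at e2
  have e3 : u.1.1 = 0 := Prod.ext hz e2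
  have e4 : u.1 = 0 := Subtype.ext e3
  exact Subtype.ext e4

/-! ### The derivative of the energy and the Nehari constraint -/

theorem inclLp_eq_zero {X : Type*} [MeasurableSpace X] {μ : Measure X} [IsFiniteMeasure μ]
    {F : Type*} [NormedAddCommGroup F] [NormedSpace ℝ F] {p q : ℝ≥0∞} [Fact (1 ≤ p)]
    [Fact (1 ≤ q)] {h : p ≤ q} {f : Lp F q μ} (hf : inclLp h f = 0) : f = 0 := by
  rw [Lp.eq_zero_iff_ae_eq_zero] at hf ⊢
  exact (inclLp_coeFn h f).symm.trans hf

/-- The double phase energy as a function on `L^q × L^q`. -/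
def prodEnergy {X : Type*} [MeasurableSpace X] (μ : Measure X) [IsFiniteMeasure μ] (E : Type*)
    [NormedAddCommGroup E] [InnerProductSpace ℝ E] (p q : ℝ) [Fact (1 < p)] [Fact (1 < q)]
    (hpq : ENNReal.ofReal p ≤ ENNReal.ofReal q) (α β lam : ℝ)
    (w : Lp ℝ (ENNReal.ofReal q) μ × Lp E (ENNReal.ofReal q) μ) : ℝ :=
  α / p * ‖inclLp hpq w.2‖ ^ p + β / q * ‖w.2‖ ^ q - lam / q * ‖w.1‖ ^ q

theorem exists_hasFDerivAt_prodEnergy {X : Type*} [MeasurableSpace X] (μ : Measure X)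
    [IsFiniteMeasure μ] (E : Type*) [NormedAddCommGroup E] [InnerProductSpace ℝ E]
    [FiniteDimensional ℝ E] (p q : ℝ) [hp : Fact (1 < p)] [hq : Fact (1 < q)]
    (hpq : ENNReal.ofReal p ≤ ENNReal.ofReal q) (α β lam : ℝ)
    (w : Lp ℝ (ENNReal.ofReal q) μ × Lp E (ENNReal.ofReal q) μ) :
    ∃ L : (Lp ℝ (ENNReal.ofReal q) μ × Lp E (ENNReal.ofReal q) μ) →L[ℝ] ℝ,
      HasFDerivAt (prodEnergy μ E p q hpq α β lam) L w ∧
      L w = α * ‖inclLp hpq w.2‖ ^ p + β * ‖w.2‖ ^ q - lam * ‖w.1‖ ^ q := by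
  have hp0 : p ≠ 0 := (zero_lt_one.trans hp.out).ne'
  have hq0 : q ≠ 0 := (zero_lt_one.trans hq.out).ne'
  have h1 := ((hasFDerivAt_norm_rpow_Lp (inclLp hpq w.2)).comp w
    ((inclLp hpq).hasFDerivAt.comp w hasFDerivAt_snd)).const_mul (α / p)
  have h2 := ((hasFDerivAt_norm_rpow_Lp w.2).comp w hasFDerivAt_snd).const_mul (β / q)
  have h3 := ((hasFDerivAt_norm_rpow_Lp w.1).comp w hasFDerivAt_fst).const_mul (lam / q)
  refine ⟨_, (h1.add h2).sub h3, ?_⟩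
  change α / p * normRpowDeriv (inclLp hpq w.2) (inclLp hpq w.2) + β / q * normRpowDeriv w.2 w.2
    - lam / q * normRpowDeriv w.1 w.1 = _
  rw [normRpowDeriv_self, normRpowDeriv_self, normRpowDeriv_self]
  field_simp

theorem energy_eq_prodEnergy {N : ℕ} (p q : ℝ) [Fact (1 < p)] [Fact (1 < q)]
    (hpq : ENNReal.ofReal p ≤ ENNReal.ofReal q) (Ω : Set (EuclideanSpace ℝ (Fin N)))
    [IsFiniteMeasure (volume.restrict Ω)] (α β lam : ℝ) (u : sobolevZero q Ω) :
    energy p q Ω α β lam u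
      = prodEnergy (volume.restrict Ω) (EuclideanSpace ℝ (Fin N)) p q hpq α β lam u.1.1 := by
  have e1 : ∫ x in Ω, ‖grad u x‖ ^ p = ‖inclLp hpq u.1.1.2‖ ^ p := by
    rw [norm_rpow_eq_integral]
    exact integral_congr_ae ((inclLp_coeFn hpq u.1.1.2).mono fun x hx =>
      congrArg (‖·‖ ^ p) hx.symm)
  have e2 : ∫ x in Ω, ‖grad u x‖ ^ q = ‖u.1.1.2‖ ^ q := (norm_rpow_eq_integral u.1.1.2).symm
  have e3 : ∫ x in Ω, |fn u x| ^ q = ‖u.1.1.1‖ ^ q :=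
    (norm_rpow_eq_integral u.1.1.1).symm
  unfold energy
  rw [e1, e2, e3]
  rfl

/-- Restriction to a subspace is composition with a linear contraction; this carries the derivative
from L^q × L^q down to the nested subspaces defining W^{1,q}_0. -/
theorem fderiv_comp_linear_apply {G Y : Type*} [NormedAddCommGroup G] [NormedSpace ℝ G]
    [NormedAddCommGroup Y] [NormedSpace ℝ Y] {c : G → Y} (hadd : ∀ a b, c (a + b) = c a + c b)
    (hsmul : ∀ (t : ℝ) a, c (t • a) = t • c a) (hnorm : ∀ a, ‖c a‖ ≤ ‖a‖) {F : Y → ℝ}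
    {L : Y →L[ℝ] ℝ} {u : G} (h : HasFDerivAt F L (c u)) {f : G → ℝ} (hf : ∀ a, f a = F (c a))
    (v : G) : fderiv ℝ f u v = L (c v) := by
  obtain rfl : f = fun u => F (c u) := funext hf
  let C : G →L[ℝ] Y := LinearMap.mkContinuous ⟨⟨c, hadd⟩, hsmul⟩ 1 fun a => by
    simpa using hnorm a
  have h1 : HasFDerivAt (fun u => F (C u)) (L.comp C) u := HasFDerivAt.comp u h C.hasFDerivAt
  exact congrArg (fun l : G →L[ℝ] ℝ => l v) h1.fderiv

theorem fderiv_coe_coe_apply {U V : Type*} [NormedAddCommGroup U] [NormedSpace ℝ U]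
    [NormedAddCommGroup V] [NormedSpace ℝ V] {S : Submodule ℝ (U × V)} {T : Submodule ℝ S}
    {F : U × V → ℝ} {u : T} {L : (U × V) →L[ℝ] ℝ} (h : HasFDerivAt F L u.1.1) {f : T → ℝ}
    (hf : ∀ a, f a = F a.1.1) (v : T) : fderiv ℝ f u v = L v.1.1 :=
  fderiv_comp_linear_apply (c := fun u : T => u.1.1) (fun _ _ => rfl)
    (fun _ _ => rfl) (fun _ => le_rfl) h hf v

theorem fderiv_sobolevZero_apply {N : ℕ} {q : ℝ} [Fact (1 < q)]
    {Ω : Set (EuclideanSpace ℝ (Fin N))} {u : sobolevZero q Ω}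
    {L : (Lp ℝ (ENNReal.ofReal q) (volume.restrict Ω) ×
      Lp (EuclideanSpace ℝ (Fin N)) (ENNReal.ofReal q) (volume.restrict Ω)) →L[ℝ] ℝ}
    {F : (Lp ℝ (ENNReal.ofReal q) (volume.restrict Ω) ×
      Lp (EuclideanSpace ℝ (Fin N)) (ENNReal.ofReal q) (volume.restrict Ω)) → ℝ}
    (hL : HasFDerivAt F L u.1.1) {f : sobolevZero q Ω → ℝ} (hf : ∀ a, f a = F a.1.1) :
    fderiv ℝ f u u = L u.1.1 := by
  have h := fderiv_coe_coe_apply (S := sobolev q Ω) (T := sobolevZero q Ω) (F := F) (u := u)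
    (L := L) hL hf u
  exact h

theorem fderiv_energy_apply_self {N : ℕ} (p q : ℝ) [Fact (1 < p)] [Fact (1 < q)]
    (hpq : ENNReal.ofReal p ≤ ENNReal.ofReal q) (Ω : Set (EuclideanSpace ℝ (Fin N)))
    [IsFiniteMeasure (volume.restrict Ω)] (α β lam : ℝ) (u : sobolevZero q Ω)
    {w : Lp ℝ (ENNReal.ofReal q) (volume.restrict Ω) ×
      Lp (EuclideanSpace ℝ (Fin N)) (ENNReal.ofReal q) (volume.restrict Ω)} (hw : w = u.1.1)
    {t : ℝ} (ht : t = α * ‖inclLp hpq w.2‖ ^ p + β * ‖w.2‖ ^ q - lam * ‖w.1‖ ^ q) :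
    fderiv ℝ (energy p q Ω α β lam) u u = t := by
  have h := exists_hasFDerivAt_prodEnergy (volume.restrict Ω)
    (EuclideanSpace ℝ (Fin N)) p q hpq α β lam w
  rw [← ht] at h
  subst hw
  clear ht
  refine Exists.elim h fun L h => Eq.trans ?_ h.2
  exact fderiv_sobolevZero_apply (L := L) (F := prodEnergy (volume.restrict Ω)
      (EuclideanSpace ℝ (Fin N)) p q hpq α β lam) h.1 (energy_eq_prodEnergy p q hpq Ω α β lam)

theorem mem_nehari_iff {N : ℕ} (p q : ℝ) [Fact (1 < p)] [Fact (1 < q)]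
    (hpq : ENNReal.ofReal p ≤ ENNReal.ofReal q) (Ω : Set (EuclideanSpace ℝ (Fin N)))
    [IsFiniteMeasure (volume.restrict Ω)] (α β lam : ℝ) (u : sobolevZero q Ω)
    {w : Lp ℝ (ENNReal.ofReal q) (volume.restrict Ω) ×
      Lp (EuclideanSpace ℝ (Fin N)) (ENNReal.ofReal q) (volume.restrict Ω)} (hw : w = u.1.1) :
    u ∈ nehari p q Ω α β lam ↔
      α * ‖inclLp hpq w.2‖ ^ p = lam * ‖w.1‖ ^ q - β * ‖w.2‖ ^ q ∧ u ≠ 0 := by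
  have h1 := fderiv_energy_apply_self p q hpq Ω α β lam u hw rfl
  refine Iff.trans (Iff.rfl : _ ↔ fderiv ℝ (energy p q Ω α β lam) u u = 0 ∧ u ≠ 0) ?_
  refine and_congr_left fun _ => ?_
  exact ⟨fun h => by linarith only [h.symm.trans h1], fun h => h1.trans (by linarith only [h])⟩

/-! ### Minimising the scale-invariant quotient -/

theorem norm_smul_rpow {V : Type*} [NormedAddCommGroup V] [NormedSpace ℝ V] {c : ℝ} (hc : 0 ≤ c)
    (v : V) (r : ℝ) : ‖c • v‖ ^ r = c ^ r * ‖v‖ ^ r := by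
  rw [norm_smul, Real.norm_of_nonneg hc, Real.mul_rpow hc (norm_nonneg v)]

theorem snd_ne_zero_of_mem_sobolevZeroProd {N : ℕ} (hN : 1 ≤ N) {r : ℝ} [Fact (1 < r)]
    {Ω : Set (EuclideanSpace ℝ (Fin N))} (hΩ : IsOpen Ω) (hb : Bornology.IsBounded Ω)
    {w : Lp ℝ (ENNReal.ofReal r) (volume.restrict Ω) ×
      Lp (EuclideanSpace ℝ (Fin N)) (ENNReal.ofReal r) (volume.restrict Ω)}
    (hw : w ∈ sobolevZeroProd r Ω) (h1 : w.1 ≠ 0) : w.2 ≠ 0 := by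
  obtain ⟨u, rfl⟩ := mem_sobolevZeroProd.1 hw
  obtain ⟨K, hK⟩ := exists_norm_le_norm_grad hN r hΩ hb
  intro h
  have h2 := hK u
  rw [h, norm_zero, mul_zero] at h2
  exact h1 (norm_le_zero_iff.1 h2)

/-- The quotient of `‖Du‖_p^q` by `lam ‖u‖_q^q - β ‖Du‖_q^q` attains its minimum among the `u` in
`W^{1,q}_0(Ω)` for which the denominator is positive. -/
theorem exists_ratio_minimizer {N : ℕ} (hN : 1 ≤ N) (p q : ℝ) [Fact (1 < p)] [hq : Fact (1 < q)]
    (hpq : ENNReal.ofReal p ≤ ENNReal.ofReal q) {Ω : Set (EuclideanSpace ℝ (Fin N))}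
    [IsFiniteMeasure (volume.restrict Ω)] (hΩ : IsOpen Ω) (hb : Bornology.IsBounded Ω)
    {β lam : ℝ} (hβ : 0 < β)
    (hex : ∃ z ∈ sobolevZeroProd q Ω, 0 < lam * ‖z.1‖ ^ q - β * ‖z.2‖ ^ q) :
    ∃ y ∈ sobolevZeroProd q Ω, 0 < ‖inclLp hpq y.2‖ ∧ 0 < lam * ‖y.1‖ ^ q - β * ‖y.2‖ ^ q ∧
      ∀ z ∈ sobolevZeroProd q Ω, 0 < lam * ‖z.1‖ ^ q - β * ‖z.2‖ ^ q →
        ‖inclLp hpq y.2‖ ^ q * (lam * ‖z.1‖ ^ q - β * ‖z.2‖ ^ q)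
          ≤ ‖inclLp hpq z.2‖ ^ q * (lam * ‖y.1‖ ^ q - β * ‖y.2‖ ^ q) := by
  have h0 : 0 < q := zero_lt_one.trans hq.out
  let D : Lp ℝ (ENNReal.ofReal q) (volume.restrict Ω) ×
      Lp (EuclideanSpace ℝ (Fin N)) (ENNReal.ofReal q) (volume.restrict Ω) → ℝ :=
    fun z => lam * ‖z.1‖ ^ q - β * ‖z.2‖ ^ q
  let A : Lp ℝ (ENNReal.ofReal q) (volume.restrict Ω) ×
      Lp (EuclideanSpace ℝ (Fin N)) (ENNReal.ofReal q) (volume.restrict Ω) → ℝ :=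
    fun z => ‖inclLp hpq z.2‖ ^ q
  have hA0 : ∀ z, 0 ≤ A z := fun z => by positivity
  have hD : ∀ z, D z = lam * ‖z.1‖ ^ q - β * ‖z.2‖ ^ q := fun z => rfl
  have hDs : ∀ c : ℝ, 0 ≤ c → ∀ z, D (c • z) = c ^ q * D z := fun c hc z => by
    simp only [hD, Prod.smul_fst, Prod.smul_snd, norm_smul_rpow hc]; ring
  have hAs : ∀ c : ℝ, 0 ≤ c → ∀ z, A (c • z) = c ^ q * A z := fun c hc z => by
    simp only [A, Prod.smul_snd, map_smul, norm_smul_rpow hc]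
  have hlam : 0 < lam := by
    obtain ⟨z, -, hz⟩ := hex
    have h1 : 0 ≤ β * ‖z.2‖ ^ q := by positivity
    by_contra! h2
    have h3 : lam * ‖z.1‖ ^ q ≤ 0 := mul_nonpos_of_nonpos_of_nonneg h2 (by positivity)
    linarith
  have hfst : ∀ z, 0 < D z → z.1 ≠ 0 := by
    intro z hz h1
    have h2 : 0 ≤ β * ‖z.2‖ ^ q := by positivity
    rw [hD, h1, norm_zero, Real.zero_rpow h0.ne'] at hz
    linarith
  let T : Set (Lp ℝ (ENNReal.ofReal q) (volume.restrict Ω) ×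
      Lp (EuclideanSpace ℝ (Fin N)) (ENNReal.ofReal q) (volume.restrict Ω)) :=
    {z | z ∈ sobolevZeroProd q Ω ∧ ‖z.1‖ = 1 ∧ 0 < D z}
  let S : Set ℝ := (fun z => A z / D z) '' T
  have hbdd : BddBelow S :=
    ⟨0, by rintro _ ⟨z, hz, rfl⟩; exact div_nonneg (hA0 z) hz.2.2.le⟩
  have hscale : ∀ z ∈ sobolevZeroProd q Ω, 0 < D z → ‖z.1‖⁻¹ • z ∈ T := by
    intro z hz hzD
    have h1 := norm_pos_iff.2 (hfst z hzD)
    refine ⟨Submodule.smul_mem _ _ hz, ?_, ?_⟩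
    · rw [Prod.smul_fst, norm_smul, norm_inv, norm_norm, inv_mul_cancel₀ h1.ne']
    · rw [hDs _ (by positivity)]; positivity
  have hS : S.Nonempty := by
    obtain ⟨z, hz, hzD⟩ := hex
    exact ⟨_, _, hscale z hz hzD, rfl⟩
  have hseq : ∀ k : ℕ, ∃ z ∈ T, A z / D z < sInf S + 1 / ((k : ℝ) + 1) := by
    intro k
    obtain ⟨_, ⟨z, hz, rfl⟩, h⟩ := exists_lt_of_csInf_lt hS
      (lt_add_of_pos_right (sInf S) (Nat.one_div_pos_of_nat (n := k)))
    exact ⟨z, hz, h⟩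
  choose z hz hzS using hseq
  -- Positivity of D with ‖u‖_q = 1 reads β‖Du‖_q^q < λ.
  have hzM : ∀ k, ‖(z k).2‖ ≤ (lam / β) ^ q⁻¹ := by
    intro k
    rw [Real.le_rpow_inv_iff_of_pos (norm_nonneg _) (by positivity) h0, le_div_iff₀' hβ]
    have := (hz k).2.2
    rw [hD, (hz k).2.1, Real.one_rpow, mul_one] at this
    linarith
  obtain ⟨y, hy, hy1, hys⟩ := exists_mem_sobolevZeroProd_of_bounded q hΩ hb
    (fun k => (hz k).1) (fun k => (hz k).2.1) hzM
  have hs0 : 0 ≤ sInf S :=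
    le_csInf hS (by rintro _ ⟨z, hz, rfl⟩; exact div_nonneg (hA0 z) hz.2.2.le)
  have hyε : ∀ ε : ℝ, 0 < ε → A y ≤ (sInf S + ε) * D y := by
    intro ε hε
    -- This is A ≤ (m + ε)D, with m = `sInf S`, after ‖v.1‖ = 1 is substituted and the gradient term
    -- moved to the left. The normalisation removes the only term that would spoil convexity.
    have hmem := hys {v | A v + (sInf S + ε) * β * ‖v.2‖ ^ q ≤ (sInf S + ε) * lam} ?_ ?_ ?_
    · change A y + (sInf S + ε) * β * ‖y.2‖ ^ q ≤ (sInf S + ε) * lam at hmem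
      rw [hD, hy1, Real.one_rpow]
      linarith
    · have c1 : ConvexOn ℝ univ A :=
        (convexOn_norm_rpow (E := Lp (EuclideanSpace ℝ (Fin N)) (ENNReal.ofReal p)
          (volume.restrict Ω)) hq.out.le).comp_linearMap
          ((inclLp hpq).toLinearMap.comp (LinearMap.snd ℝ _ _))
      have c2 := (convexOn_norm_snd_rpow (U := Lp ℝ (ENNReal.ofReal q) (volume.restrict Ω))
        (V := Lp (EuclideanSpace ℝ (Fin N)) (ENNReal.ofReal q) (volume.restrict Ω))
        hq.out.le).smul (c := (sInf S + ε) * β) (by positivity)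
      simpa using (c1.add c2).convex_le ((sInf S + ε) * lam)
    · have k1 : Continuous A :=
        ((inclLp hpq).continuous.comp continuous_snd).norm.rpow_const fun _ => Or.inr h0.le
      have k2 : Continuous fun v : Lp ℝ (ENNReal.ofReal q) (volume.restrict Ω) ×
          Lp (EuclideanSpace ℝ (Fin N)) (ENNReal.ofReal q) (volume.restrict Ω) => ‖v.2‖ ^ q :=
        continuous_snd.norm.rpow_const fun _ => Or.inr h0.le
      exact isClosed_le (k1.add (continuous_const.mul k2)) continuous_const
    · filter_upwards [tendsto_one_div_add_atTop_nhds_zero_nat.eventually (gt_mem_nhds hε)]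
        with k hk
      have h1 := (div_lt_iff₀ (hz k).2.2).1 ((hzS k).trans (add_lt_add_right hk (sInf S)))
      rw [hD, (hz k).2.1, Real.one_rpow] at h1
      change A (z k) + (sInf S + ε) * β * ‖(z k).2‖ ^ q ≤ (sInf S + ε) * lam
      linarith
  have hy0 : y.1 ≠ 0 := norm_ne_zero_iff.1 (hy1.trans_ne one_ne_zero)
  have hι : 0 < ‖inclLp hpq y.2‖ :=
    norm_pos_iff.2 fun h => snd_ne_zero_of_mem_sobolevZeroProd hN hΩ hb hy hy0 (inclLp_eq_zero h)
  have hAy : 0 < A y := Real.rpow_pos_of_pos hι q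
  -- Passing to the limit in D > 0 would yield only D ≥ 0; strictness comes from 0 < A(y) ≤ (m +
  -- 1)D(y).
  have hDy : 0 < D y := pos_of_mul_pos_right (hAy.trans_le (hyε 1 one_pos)) (by positivity)
  have hyS : A y ≤ sInf S * D y := by
    refine le_of_forall_pos_le_add fun ε hε => ?_
    have := hyε (ε / D y) (by positivity)
    rwa [add_mul, div_mul_cancel₀ _ hDy.ne'] at this
  refine ⟨y, hy, hι, hDy, fun v hv hvD => ?_⟩
  change A y * D v ≤ A v * D y
  have hvD' : 0 < D v := hvD
  have hc : 0 < ‖v.1‖⁻¹ := inv_pos.2 (norm_pos_iff.2 (hfst v hvD))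
  have h1 : sInf S ≤ _ := csInf_le hbdd ⟨_, hscale v hv hvD, rfl⟩
  simp only [hAs _ hc.le, hDs _ hc.le] at h1
  rw [mul_div_mul_left _ _ (Real.rpow_pos_of_pos hc q).ne', le_div_iff₀ hvD'] at h1
  calc A y * D v ≤ sInf S * D y * D v := by gcongr
    _ = sInf S * D v * D y := by ring
    _ ≤ A v * D y := by gcongr

/-! ### From the quotient back to the Nehari manifold -/

theorem exists_mem_sobolevZeroProd_pos {N : ℕ} {q : ℝ} [hq : Fact (1 < q)]
    {Ω : Set (EuclideanSpace ℝ (Fin N))} [IsFiniteMeasure (volume.restrict Ω)] (hΩ : IsOpen Ω)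
    (hb : Bornology.IsBounded Ω) (hne : Ω.Nonempty) {β lam : ℝ} (hβ : 0 < β)
    (hlam : β * principalEigenvalue q Ω < lam) :
    ∃ z ∈ sobolevZeroProd q Ω, 0 < lam * ‖z.1‖ ^ q - β * ‖z.2‖ ^ q := by
  obtain ⟨mu, hmu, hlt⟩ := exists_lt_of_csInf_lt (s := {mu | IsEigenvalue q Ω mu})
    (exists_isEigenvalue q hΩ hb hne) ((lt_div_iff₀' hβ).2 hlam)
  obtain ⟨z, hz, hz0, h⟩ := hmu.exists_norm_grad_eq
  refine ⟨z, hz, ?_⟩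
  rw [h, ← mul_assoc, ← sub_mul]
  have := (lt_div_iff₀' hβ).1 hlt
  exact mul_pos (sub_pos.2 this) (Real.rpow_pos_of_pos (norm_pos_iff.2 hz0) q)

/-- The constraint divided by q eliminates both q-th power terms. -/
theorem energy_eq_of_mem_nehari {N : ℕ} {p q : ℝ} [Fact (1 < p)] [hq : Fact (1 < q)]
    (hpq : ENNReal.ofReal p ≤ ENNReal.ofReal q) {Ω : Set (EuclideanSpace ℝ (Fin N))}
    [IsFiniteMeasure (volume.restrict Ω)] {α β lam : ℝ} {u : sobolevZero q Ω}
    (hu : u ∈ nehari p q Ω α β lam) :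
    energy p q Ω α β lam u = α * (1 / p - 1 / q) * ‖inclLp hpq u.1.1.2‖ ^ p := by
  have h := ((mem_nehari_iff p q hpq Ω α β lam u rfl).1 hu).1
  have h0 : q ≠ 0 := (zero_lt_one.trans hq.out).ne'
  rw [energy_eq_prodEnergy p q hpq, prodEnergy]
  linear_combination (1 / q) * h

theorem norm_inclLp_grad_pos {N : ℕ} {p q : ℝ} [Fact (1 < p)] [hq : Fact (1 < q)]
    (hpq : ENNReal.ofReal p ≤ ENNReal.ofReal q) (hN : 1 ≤ N) {Ω : Set (EuclideanSpace ℝ (Fin N))}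
    [IsFiniteMeasure (volume.restrict Ω)] (hΩ : IsOpen Ω) (hb : Bornology.IsBounded Ω)
    {u : sobolevZero q Ω} (hu : u ≠ 0) : 0 < ‖inclLp hpq u.1.1.2‖ := by
  refine norm_pos_iff.2 fun h => hu ?_
  have h2 : u.1.1.2 = 0 := inclLp_eq_zero h
  have h1 : u.1.1.1 = 0 := by
    by_contra h1
    exact snd_ne_zero_of_mem_sobolevZeroProd hN hΩ hb (mem_sobolevZeroProd.2 ⟨u, rfl⟩) h1 h2
  have e3 : u.1.1 = 0 := Prod.ext h1 h2
  have e4 : u.1 = 0 := Subtype.ext e3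
  exact Subtype.ext e4

/-- The hypothesis says (a/b)^q ≤ (a/b)^p, which fails when a/b > 1. -/
theorem le_of_rpow_mul_rpow_le {a b p q : ℝ} (ha : 0 < a) (hb : 0 < b) (hpq : p < q)
    (h : a ^ q * b ^ p ≤ b ^ q * a ^ p) : a ≤ b := by
  by_contra! hlt
  have h1 := Real.rpow_lt_rpow_of_exponent_lt ((one_lt_div hb).2 hlt) hpq
  rw [Real.div_rpow ha.le hb.le, Real.div_rpow ha.le hb.le, div_lt_div_iff₀ (by positivity)
    (by positivity)] at h1
  linarith

theorem exists_scaled_ratio_minimizer {N : ℕ} (hN : 1 ≤ N) {p q : ℝ} [hp : Fact (1 < p)]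
    [hq : Fact (1 < q)] (hpq : p < q) (hpq' : ENNReal.ofReal p ≤ ENNReal.ofReal q)
    {Ω : Set (EuclideanSpace ℝ (Fin N))}
    [IsFiniteMeasure (volume.restrict Ω)] (hΩ : IsOpen Ω) (hb : Bornology.IsBounded Ω)
    (hne : Ω.Nonempty) {α β lam : ℝ} (hα : 0 < α) (hβ : 0 < β)
    (hlam : β * principalEigenvalue q Ω < lam) :
    ∃ y ∈ sobolevZeroProd q Ω, 0 < ‖inclLp hpq' y.2‖ ∧
      α * ‖inclLp hpq' y.2‖ ^ p = lam * ‖y.1‖ ^ q - β * ‖y.2‖ ^ q ∧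
      ∀ z ∈ sobolevZeroProd q Ω, 0 < ‖inclLp hpq' z.2‖ →
        α * ‖inclLp hpq' z.2‖ ^ p = lam * ‖z.1‖ ^ q - β * ‖z.2‖ ^ q →
        ‖inclLp hpq' y.2‖ ≤ ‖inclLp hpq' z.2‖ := by
  obtain ⟨y, hy, hι, hD, hmin⟩ := exists_ratio_minimizer hN p q hpq' hΩ hb hβ
    (exists_mem_sobolevZeroProd_pos hΩ hb hne hβ hlam)
  -- The point t • y satisfies the constraint when α t^p ‖Dy‖_p^p = t^q D(y), that is, when t^(q−p)
  -- = s.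
  let s : ℝ := α * ‖inclLp hpq' y.2‖ ^ p / (lam * ‖y.1‖ ^ q - β * ‖y.2‖ ^ q)
  have hs : 0 < s := div_pos (mul_pos hα (Real.rpow_pos_of_pos hι p)) hD
  let t : ℝ := s ^ (q - p)⁻¹
  have ht : 0 < t := Real.rpow_pos_of_pos hs _
  have hts : t ^ q = t ^ p * s := by
    have h1 : t ^ (q - p) = s := Real.rpow_inv_rpow hs.le (sub_pos.2 hpq).ne'
    rw [← h1, ← Real.rpow_add ht, add_sub_cancel]
  have eι : ∀ r : ℝ, ‖inclLp hpq' (t • y).2‖ ^ r = t ^ r * ‖inclLp hpq' y.2‖ ^ r := fun r => by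
    rw [Prod.smul_snd, map_smul, norm_smul_rpow ht.le]
  have eD : lam * ‖(t • y).1‖ ^ q - β * ‖(t • y).2‖ ^ q
      = t ^ q * (lam * ‖y.1‖ ^ q - β * ‖y.2‖ ^ q) := by
    rw [Prod.smul_fst, Prod.smul_snd, norm_smul_rpow ht.le, norm_smul_rpow ht.le]
    ring
  have hN' : α * ‖inclLp hpq' (t • y).2‖ ^ p
      = lam * ‖(t • y).1‖ ^ q - β * ‖(t • y).2‖ ^ q := by
    rw [eι, eD, hts, mul_assoc, div_mul_cancel₀ _ hD.ne']
    ring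
  have hιt : 0 < ‖inclLp hpq' (t • y).2‖ := by
    rw [Prod.smul_snd, map_smul, norm_smul]
    exact mul_pos (norm_pos_iff.2 ht.ne') hι
  refine ⟨t • y, Submodule.smul_mem _ t hy, hιt, hN', fun z hz hzι hzN => ?_⟩
  have h1 := hmin z hz (hzN ▸ mul_pos hα (Real.rpow_pos_of_pos hzι p))
  -- On the manifold D may be replaced by α‖Du‖_p^p. The minimality of the quotient, scaled by t^q,
  -- then involves only the two gradient norms, raised to the powers p and q.
  have h2 : ‖inclLp hpq' (t • y).2‖ ^ q * (α * ‖inclLp hpq' z.2‖ ^ p)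
      ≤ ‖inclLp hpq' z.2‖ ^ q * (α * ‖inclLp hpq' (t • y).2‖ ^ p) := by
    rw [hzN, hN', eι, eD]
    linarith only [mul_le_mul_of_nonneg_left h1 (Real.rpow_nonneg ht.le q)]
  refine le_of_rpow_mul_rpow_le hιt hzι hpq (le_of_mul_le_mul_left ?_ hα)
  linarith only [h2]

theorem energy_le_of_norm_le {N : ℕ} {p q : ℝ} [hp : Fact (1 < p)] [hq : Fact (1 < q)]
    (hpq : p < q) (hpq' : ENNReal.ofReal p ≤ ENNReal.ofReal q)
    {Ω : Set (EuclideanSpace ℝ (Fin N))} [IsFiniteMeasure (volume.restrict Ω)] {α β lam : ℝ}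
    (hα : 0 < α) {u v : sobolevZero q Ω} (hu : u ∈ nehari p q Ω α β lam)
    (hv : v ∈ nehari p q Ω α β lam) (h : ‖inclLp hpq' u.1.1.2‖ ≤ ‖inclLp hpq' v.1.1.2‖) :
    energy p q Ω α β lam u ≤ energy p q Ω α β lam v := by
  have hp0 : 0 < p := zero_lt_one.trans hp.out
  refine (energy_eq_of_mem_nehari hpq' hu).trans_le
    (le_trans ?_ (energy_eq_of_mem_nehari hpq' hv).ge)
  have h4 : 0 ≤ 1 / p - 1 / q := sub_nonneg.2 (one_div_le_one_div_of_le hp0 hpq.le)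
  exact mul_le_mul_of_nonneg_left (Real.rpow_le_rpow (norm_nonneg _) h hp0.le)
    (mul_nonneg hα.le h4)

theorem exists_mem_nehari_energy_le {N : ℕ} (hN : 1 ≤ N) {p q : ℝ} [hp : Fact (1 < p)]
    [hq : Fact (1 < q)] (hpq : p < q) {Ω : Set (EuclideanSpace ℝ (Fin N))}
    [IsFiniteMeasure (volume.restrict Ω)] (hΩ : IsOpen Ω) (hb : Bornology.IsBounded Ω)
    (hne : Ω.Nonempty) {α β lam : ℝ} (hα : 0 < α) (hβ : 0 < β)
    (hlam : β * principalEigenvalue q Ω < lam) :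
    ∃ u ∈ nehari p q Ω α β lam, ∀ v ∈ nehari p q Ω α β lam,
      energy p q Ω α β lam u ≤ energy p q Ω α β lam v := by
  have hpq' : ENNReal.ofReal p ≤ ENNReal.ofReal q := ENNReal.ofReal_le_ofReal hpq.le
  have h := exists_scaled_ratio_minimizer hN hpq hpq' hΩ hb hne hα hβ hlam
  refine Exists.elim h fun y hy => Exists.elim (mem_sobolevZeroProd.1 hy.1) fun u hu => ?_
  have hu0 : u ≠ 0 := by
    intro h
    have h1 : y.2 = 0 := by rw [← hu, h]; rfl
    exact (norm_pos_iff.1 hy.2.1) (by rw [h1, map_zero])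
  have huN : u ∈ nehari p q Ω α β lam :=
    (mem_nehari_iff p q hpq' Ω α β lam u hu.symm).2 ⟨hy.2.2.1, hu0⟩
  refine ⟨u, huN, fun v hv => energy_le_of_norm_le hpq hpq' hα huN hv ?_⟩
  have h1 := (mem_nehari_iff p q hpq' Ω α β lam v rfl).1 hv
  have h2 := hy.2.2.2 v.1.1 (mem_sobolevZeroProd.2 ⟨v, rfl⟩)
    (norm_inclLp_grad_pos hpq' hN hΩ hb h1.2) h1.1
  rwa [← hu] at h2

theorem energy_eq_nehariInf {N : ℕ} {p q : ℝ} [Fact (1 < q)]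
    {Ω : Set (EuclideanSpace ℝ (Fin N))} {α β lam : ℝ} {u : sobolevZero q Ω}
    (hu : u ∈ nehari p q Ω α β lam)
    (hmin : ∀ v ∈ nehari p q Ω α β lam, energy p q Ω α β lam u ≤ energy p q Ω α β lam v) :
    energy p q Ω α β lam u = nehariInf p q Ω α β lam := by
  have hleast : IsLeast (energy p q Ω α β lam '' nehari p q Ω α β lam)
      (energy p q Ω α β lam u) :=
    ⟨mem_image_of_mem _ hu, forall_mem_image.2 hmin⟩
  exact hleast.csInf_eq.symm

end DoublePhase

end

theorem proposition5 {N : ℕ} (hN : 1 ≤ N) (Ω : Set (EuclideanSpace ℝ (Fin N)))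
    (hΩ : DoublePhase.IsBoundedC2Domain Ω) (p q : ℝ) (hp : 1 < p) [Fact (1 < q)] (hpq : p < q)
    (α β lam : ℝ) (hα : 0 < α) (hβ : 0 < β)
    (hlam : β * DoublePhase.principalEigenvalue q Ω < lam) :
    ∃ u ∈ DoublePhase.nehari p q Ω α β lam,
      DoublePhase.energy p q Ω α β lam u = DoublePhase.nehariInf p q Ω α β lam ∧
      ∀ v ∈ DoublePhase.nehari p q Ω α β lam,
        DoublePhase.energy p q Ω α β lam u ≤ DoublePhase.energy p q Ω α β lam v := by
  have : Fact (1 < p) := ⟨hp⟩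
  have : IsFiniteMeasure (volume.restrict Ω) :=
    isFiniteMeasure_restrict.2 hΩ.isBounded.measure_lt_top.ne
  have h := DoublePhase.exists_mem_nehari_energy_le hN hpq hΩ.isOpen hΩ.isBounded
    hΩ.isConnected.nonempty hα hβ hlam
  exact h.imp fun u hu => ⟨hu.1, DoublePhase.energy_eq_nehariInf hu.1 hu.2, hu.2⟩
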